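/- There are computable functions $C_0:\mathbf N\to\mathbf N$ and $c_0:\mathbf N\times\mathbf N\to\mathbf N$ such that, with $C(\epsilon)=C_0(\lceil 1/\epsilon\rceil)$ and $c(p,\epsilon)=c_0(p,\lceil 1/\epsilon\rceil)$, the following holds for all $p\in\mathbf N$ and all real $\epsilon>0$. Let $D=\{z\in\mathbf C:|z-a|<r\}$ be a disc ($a\in\mathbf C$, $r>0$) and let $f_1,f_2$ be holomorphic on $D$ and $p$-valent there, i.e. each $f_i$ takes every complex value at most $p$ times on $D$. For real $H\ge1$ consider the points $(f_1(z),f_2(z))$ with $|z-a|\le r/2$ that are rational, i.e. lie in $\mathbf Q^2$, and have height at most $H$. All these points lie on the union of at most $c(p,\epsilon)H^{\epsilon}$ algebraic curves in $\mathbf C^2$ of degree $C(\epsilon)$. Here the height of a rational number $u/v$ in lowest terms, $v>0$, is $\max(|u|,v)$, the height of a point of $\mathbf Q^2$ is the larger of the heights of its two coordinates, and an algebraic curve of degree $d\ge1$ is the zero set in $\mathbf C^2$ of a polynomial in $\mathbf C[X,Y]$ of total degree $d$ (not necessarily irreducible or reduced). -/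

import Mathlib

/-- `f` is `p`-valent on `D`: it takes every complex value at most `p` times on `D`.
(For a nonconstant holomorphic function on a connected open set it makes no difference whether the
solutions of `f z = w` are counted with or without multiplicity: a value taken with total
multiplicity `m` has nearby values that are taken at `m` or more distinct points.) -/
def IsPValentOn (p : ℕ) (f : ℂ → ℂ) (D : Set ℂ) : Prop :=
  ∀ w : ℂ, {z ∈ D | f z = w}.encard ≤ p

/-- `Γ` is a plane algebraic curve of degree `d`: the zero set in `ℂ²` of a nonconstant polynomial
of total degree exactly `d`. -/
def IsPlaneCurveOfDegree (d : ℕ) (Γ : Set (ℂ × ℂ)) : Prop :=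
  1 ≤ d ∧ ∃ P : MvPolynomial (Fin 2) ℂ, P.totalDegree = d ∧
    Γ = {w : ℂ × ℂ | MvPolynomial.eval ![w.1, w.2] P = 0}

/-- The rational points of `ℂ²` of height at most `H`, where the height of a point is the larger
of the multiplicative heights `max |a| b` of its coordinates `a / b` (in lowest terms). -/
def rationalPointsOfHeightLE (H : ℝ) : Set (ℂ × ℂ) :=
  {w | ∃ x y : ℚ, w = ((x : ℂ), (y : ℂ)) ∧ max (Height.mulHeight₁ x) (Height.mulHeight₁ y) ≤ H}

/-! A rational point of height at most `H` has coordinates of modulus at most `H`, so only the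
places where both functions are at most `H` matter. If both were bounded by a constant times `H` on
a fixed disc, the determinant-free Bombieri–Pila argument would finish. Siegel's lemma gives a
nonzero integer polynomial `P` of bounded degree for which the first Taylor coefficients of `P(f₁,
f₂)` at a centre are tiny. Then `P(f₁, f₂)` is tiny on a slightly shrunken disc. Its value at a
rational point, once denominators are cleared, is an integer of modulus below 1, hence zero. About
`H ^ (1/n)` shrunken discs, with `n = ⌈1/ε⌉`, fill half of the disc.

Valency supplies the bounded discs, in a number depending only on `p` (`IsPValentOn.exists_cover`).
A logarithm of a zero-free `p`-valent function cannot cover a large disc, so a Bloch-type theorem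
bounds its derivative; this is a Harnack inequality. Chaining it along paths that avoid the at most
`p` zeros gives a doubling inequality with constant independent of `f`. Hence the set where `|f| ≤
H` is covered by discs of fixed relative size away from the zeros and one maximal disc around each
zero, with `|f|` at most a constant times `H` on the doubled discs. Covering first for `f₁`, then
for `f₂` inside each disc, reduces to the bounded case. -/

open Metric Set

/-! ### Bloch's theorem and Harnack's inequality for zero-free `p`-valent functions -/

/-- A weak form of Bloch's theorem: the image of a holomorphic function on a disc contains a disc
of radius comparable to the product of the radius and the derivative at the centre. -/
theorem exists_ball_subset_image_of_differentiableOn_ball {g : ℂ → ℂ} {z₀ : ℂ} {R : ℝ}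
    (hR : 0 < R) (hg : DifferentiableOn ℂ g (ball z₀ R)) :
    ∃ w, ball w (R * ‖deriv g z₀‖ / 96) ⊆ g '' ball z₀ R := by
  rcases (norm_nonneg (deriv g z₀)).eq_or_lt with h0 | h0
  · exact ⟨0, by simp [← h0]⟩
  have hg' : DifferentiableOn ℂ (deriv g) (ball z₀ R) := hg.deriv isOpen_ball
  have hsub : closedBall z₀ (R / 2) ⊆ ball z₀ R := closedBall_subset_ball (by linarith)
  -- The derivative is weighted by the distance to the edge of the half disc. Around a maximiser `y`
  -- it then at most doubles on the disc whose radius `t` is half that distance.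
  have hcont : ContinuousOn (fun z => (R / 2 - dist z z₀) * ‖deriv g z‖) (closedBall z₀ (R / 2)) :=
    (by fun_prop : Continuous fun z => R / 2 - dist z z₀).continuousOn.mul
      (hg'.continuousOn.mono hsub).norm
  obtain ⟨y, hy, hmax⟩ := (isCompact_closedBall z₀ (R / 2)).exists_isMaxOn
    ⟨z₀, mem_closedBall_self (by linarith)⟩ hcont
  have hmax' : ∀ z ∈ closedBall z₀ (R / 2),
      (R / 2 - dist z z₀) * ‖deriv g z‖ ≤ (R / 2 - dist y z₀) * ‖deriv g y‖ := hmax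
  set m := ‖deriv g y‖ with hm
  set t := (R / 2 - dist y z₀) / 2 with ht
  have hc := hmax' z₀ (mem_closedBall_self (by linarith))
  rw [dist_self, sub_zero, show R / 2 - dist y z₀ = 2 * t by rw [ht]; ring] at hc
  have hpos : 0 < 2 * t * m := lt_of_lt_of_le (by positivity) hc
  have ht0 : 0 < t := by
    have : 0 ≤ t := by rw [mem_closedBall] at hy; rw [ht]; linarith
    rcases this.eq_or_lt with h | h
    · simp [← h] at hpos
    · exact h
  have hm0 : 0 < m := by
    rcases (norm_nonneg (deriv g y)).eq_or_lt with h | h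
    · rw [← hm] at h; simp [← h] at hpos
    · exact h
  have hballt : ∀ z ∈ ball y t, z ∈ closedBall z₀ (R / 2) ∧ t ≤ R / 2 - dist z z₀ := by
    intro z hz
    rw [mem_ball] at hz
    have := dist_triangle z y z₀
    have h2 : t ≤ R / 2 - dist z z₀ := by linarith
    exact ⟨by rw [mem_closedBall]; linarith, h2⟩
  have hderiv : ∀ z ∈ ball y t, ‖deriv g z‖ ≤ 2 * m := by
    intro z hz
    obtain ⟨h1, h2⟩ := hballt z hz
    have h3 := hmax' z h1
    have h4 : t * ‖deriv g z‖ ≤ (R / 2 - dist z z₀) * ‖deriv g z‖ := by gcongr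
    have h5 : t * ‖deriv g z‖ ≤ t * (2 * m) := by
      rw [show R / 2 - dist y z₀ = 2 * t by rw [ht]; ring] at h3; linarith
    exact le_of_mul_le_mul_left h5 ht0
  have hballsub : ball y t ⊆ ball z₀ R := fun z hz => hsub (hballt z hz).1
  have hmaps : MapsTo (deriv g) (ball y t) (closedBall (deriv g y) (3 * m)) := by
    intro z hz
    rw [mem_closedBall, dist_eq_norm]
    calc ‖deriv g z - deriv g y‖ ≤ ‖deriv g z‖ + ‖deriv g y‖ := norm_sub_le _ _
      _ ≤ 3 * m := by have := hderiv z hz; linarith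
  set s := t / 6 with hs
  have hs0 : 0 < s := by positivity
  have hcb : closedBall y s ⊆ ball y t := closedBall_subset_ball (by linarith)
  have hclose : ∀ z ∈ closedBall y s, ‖deriv g z - deriv g y‖ ≤ m / 2 := by
    intro z hz
    -- Schwarz's lemma for the derivative: within `t / 6` of `y` it varies by at most `m / 2`, so
    -- distances from `y` shrink under `g` at most by the factor `m / 2`.
    have h := Complex.dist_le_div_mul_dist_of_mapsTo_ball (hg'.mono hballsub) hmaps (hcb hz)
    rw [dist_eq_norm] at h
    refine h.trans ?_
    calc 3 * m / t * dist z y ≤ 3 * m / t * s := by gcongr; exact hz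
      _ = m / 2 := by rw [hs]; field_simp; norm_num
  have hdat : ∀ z ∈ closedBall y s, DifferentiableAt ℂ g z := fun z hz =>
    hg.differentiableAt (isOpen_ball.mem_nhds (hballsub (hcb hz)))
  have hlow : ∀ z ∈ closedBall y s, m / 2 * ‖z - y‖ ≤ ‖g z - g y‖ := by
    intro z hz
    have hh := (convex_closedBall y s).norm_image_sub_le_of_norm_deriv_le (𝕜 := ℂ)
      (f := fun z => g z - deriv g y * z) (C := m / 2) (x := y) (y := z)
      (fun x hx => (hdat x hx).sub (by fun_prop))
      (fun x hx => by
        rw [show deriv (fun z => g z - deriv g y * z) x = deriv g x - deriv g y from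
          ((hdat x hx).hasDerivAt.sub (by
            simpa using (hasDerivAt_id x).const_mul (deriv g y))).deriv]
        exact hclose x hx) (mem_closedBall_self hs0.le) hz
    have h2 : ‖deriv g y * (z - y)‖ ≤
        ‖g z - g y‖ + ‖g z - deriv g y * z - (g y - deriv g y * y)‖ := by
      rw [← norm_neg (g z - deriv g y * z - (g y - deriv g y * y))]
      refine le_trans (le_of_eq ?_) (norm_add_le _ _)
      congr 1; ring
    rw [norm_mul, ← hm] at h2
    linarith
  refine ⟨g y, ?_⟩
  have hfin := DiffContOnCl.ball_subset_image_closedBall (f := g) (z₀ := y) (r := s)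
    (ε := m / 2 * s)
    (DifferentiableOn.diffContOnCl (by
      rw [closure_ball _ hs0.ne']; exact hg.mono (hcb.trans hballsub))) hs0
    (fun z hz => by
      have := hlow z (sphere_subset_closedBall hz)
      rwa [← dist_eq_norm, mem_sphere.1 hz] at this)
    (by
      have h1 : ∃ᶠ z in nhdsWithin y {y}ᶜ, z ∈ closedBall y s :=
        Filter.Eventually.frequently (nhdsWithin_le_nhds (closedBall_mem_nhds y hs0))
      have h2 : ∀ᶠ z in nhdsWithin y {y}ᶜ, z ≠ y := self_mem_nhdsWithin
      refine ((h1.and_eventually h2).filter_mono nhdsWithin_le_nhds).mono ?_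
      rintro z ⟨hz, hne⟩ heq
      have h3 := hlow z hz
      rw [heq, sub_self, norm_zero] at h3
      have : 0 < m / 2 * ‖z - y‖ := by
        have := norm_pos_iff.2 (sub_ne_zero.2 hne); positivity
      linarith)
  -- The image disc has radius `m * s / 4 = m * t / 24`, while maximality at `y` gives `2 * t * m ≥
  -- R / 2 * ‖deriv g z₀‖`.
  refine (ball_subset_ball ?_).trans (hfin.trans (image_mono (hcb.trans hballsub)))
  have : m * s = m * t / 6 := by rw [hs]; ring
  nlinarith

/-- A zero-free holomorphic function on a disc is an exponential. -/
theorem exists_exp_eq_of_ne_zero_on_ball {f : ℂ → ℂ} {z₀ : ℂ} {R : ℝ}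
    (hf : DifferentiableOn ℂ f (ball z₀ R)) (hne : ∀ z ∈ ball z₀ R, f z ≠ 0) :
    ∃ g : ℂ → ℂ, DifferentiableOn ℂ g (ball z₀ R) ∧ ∀ z ∈ ball z₀ R, f z = Complex.exp (g z) := by
  rcases le_or_gt R 0 with hR | hR
  · exact ⟨0, by simp [ball_eq_empty.2 hR]⟩
  have h0 : z₀ ∈ ball z₀ R := mem_ball_self hR
  -- The logarithm is a primitive of `f' / f`; below, `f * exp (-g)` has derivative zero.
  obtain ⟨g, hg0, hg⟩ := ((hf.deriv isOpen_ball).div hf hne).isExactOn_ball.with_val_at z₀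
    (Complex.log (f z₀))
  refine ⟨g, fun z hz => (hg z hz).differentiableAt.differentiableWithinAt, fun z hz => ?_⟩
  have hder : ∀ z ∈ ball z₀ R, HasDerivAt (fun z => f z * Complex.exp (-g z)) 0 z := by
    intro z hz
    have h1 := (hf.differentiableAt (isOpen_ball.mem_nhds hz)).hasDerivAt
    have h2 := h1.mul (hg z hz).neg.cexp
    refine h2.congr_deriv ?_
    have := hne z hz
    change deriv f z * Complex.exp (-g z) +
      f z * (Complex.exp (-g z) * -(deriv f z / f z)) = 0
    field_simp
    ring
  have hconst := isOpen_ball.is_const_of_deriv_eq_zero (convex_ball z₀ R).isPreconnected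
    (fun z hz => (hder z hz).differentiableAt.differentiableWithinAt)
    (fun z hz => (hder z hz).deriv) hz h0
  simp only [hg0] at hconst
  rw [Complex.exp_neg, Complex.exp_neg, Complex.exp_log (hne _ h0), mul_inv_cancel₀ (hne _ h0),
    mul_inv_eq_one₀ (Complex.exp_ne_zero _)] at hconst
  exact hconst

theorem IsPValentOn.mono {p : ℕ} {f : ℂ → ℂ} {D E : Set ℂ} (h : IsPValentOn p f D) (hE : E ⊆ D) :
    IsPValentOn p f E := fun w =>
  (encard_le_encard (show {z ∈ E | f z = w} ⊆ {z ∈ D | f z = w} from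
    fun _ hz => ⟨hE hz.1, hz.2⟩)).trans (h w)

/-- The image of a logarithm of a `p`-valent function misses some point of every large disc. -/
theorem IsPValentOn.not_ball_subset_image_log {p : ℕ} {f g : ℂ → ℂ} {D : Set ℂ}
    (hf : IsPValentOn p f D) (hg : ∀ z ∈ D, f z = Complex.exp (g z)) (w : ℂ) {ρ : ℝ}
    (hρ : 2 * Real.pi * p < ρ) : ¬ ball w ρ ⊆ g '' D := by
  intro hsub
  -- These `p + 1` points of the disc have the same exponential, which contradicts valency.
  have hmem : ∀ k : Fin (p + 1), ∃ z ∈ D, g z = w + (k : ℕ) * (2 * Real.pi * Complex.I) := by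
    intro k
    refine hsub ?_
    rw [mem_ball, dist_eq_norm, add_sub_cancel_left]
    have hk : ((k : ℕ) : ℝ) ≤ p := by exact_mod_cast Nat.le_of_lt_succ k.2
    have : ‖((k : ℕ) : ℂ) * (2 * Real.pi * Complex.I)‖ = 2 * Real.pi * (k : ℕ) := by
      simp [abs_of_pos Real.pi_pos]; ring
    rw [this]
    refine lt_of_le_of_lt ?_ hρ
    gcongr
  choose z hzD hz using hmem
  have hinj : Function.Injective z := by
    intro k l hkl
    have h1 := hz k
    rw [hkl, hz l] at h1
    have h2 := mul_right_cancel₀ Complex.two_pi_I_ne_zero (add_left_cancel h1)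
    exact Fin.ext (by exact_mod_cast h2.symm)
  have hle : (range z).encard ≤ p := by
    refine (encard_le_encard ?_).trans (hf (Complex.exp w))
    rintro _ ⟨k, rfl⟩
    refine ⟨hzD k, ?_⟩
    rw [hg _ (hzD k), hz k, Complex.exp_eq_exp_iff_exists_int]
    exact ⟨(k : ℕ), by push_cast; ring⟩
  rw [← image_univ, hinj.encard_image, encard_univ] at hle
  simp only [ENat.card_eq_coe_fintype_card, Fintype.card_fin] at hle
  have : p + 1 ≤ p := by exact_mod_cast hle
  omega

/-- The constant in Harnack's inequality for zero-free `p`-valent functions. -/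
def harnackConst (p : ℕ) : ℕ := 3 ^ (1000 * (p + 1))

theorem one_le_harnackConst (p : ℕ) : 1 ≤ harnackConst p := Nat.one_le_pow _ _ (by norm_num)

attribute [irreducible] harnackConst

/-- A Harnack inequality for zero-free `p`-valent functions on a disc. -/
theorem IsPValentOn.norm_le_of_ne_zero {p : ℕ} {f : ℂ → ℂ} {z₀ : ℂ} {R : ℝ}
    (hp : IsPValentOn p f (ball z₀ R)) (hf : DifferentiableOn ℂ f (ball z₀ R))
    (hne : ∀ z ∈ ball z₀ R, f z ≠ 0) (hR : 0 < R) {z : ℂ} (hz : z ∈ closedBall z₀ (R / 2)) :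
    ‖f z‖ ≤ harnackConst p * ‖f z₀‖ := by
  obtain ⟨g, hgd, hg⟩ := exists_exp_eq_of_ne_zero_on_ball hf hne
  have hsub : closedBall z₀ (R / 2) ⊆ ball z₀ R := closedBall_subset_ball (by linarith)
  have hz0 : z₀ ∈ closedBall z₀ (R / 2) := mem_closedBall_self (by linarith)
  have hder : ∀ y ∈ closedBall z₀ (R / 2), ‖deriv g y‖ ≤ 2000 * (p + 1) / R := by
    intro y hy
    by_contra hcon
    push Not at hcon
    have hb : ball y (R / 2) ⊆ ball z₀ R := by
      refine ball_subset_ball' ?_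
      rw [mem_closedBall] at hy; linarith
    -- The image disc has radius above `1000 * (p + 1) / 96`, which exceeds `2 * π * p`.
    obtain ⟨w, hw⟩ := exists_ball_subset_image_of_differentiableOn_ball (half_pos hR)
      (hgd.mono hb)
    refine (hp.mono hb).not_ball_subset_image_log (fun x hx => hg x (hb hx)) w ?_ hw
    rw [div_lt_iff₀ hR] at hcon
    have := Real.pi_lt_d2
    have hp0 : (0 : ℝ) ≤ p := Nat.cast_nonneg p
    nlinarith
  have hmv := (convex_closedBall z₀ (R / 2)).norm_image_sub_le_of_norm_deriv_le
    (fun x hx => hgd.differentiableAt (isOpen_ball.mem_nhds (hsub hx))) hder hz0 hz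
  have hbd : ‖g z - g z₀‖ ≤ 1000 * (p + 1) := by
    refine hmv.trans ?_
    calc 2000 * (p + 1) / R * ‖z - z₀‖ ≤ 2000 * (p + 1) / R * (R / 2) := by
          gcongr; rwa [← dist_eq_norm]
      _ = 1000 * (p + 1) := by field_simp; norm_num
  rw [hg z (hsub hz), hg z₀ (hsub hz0), Complex.norm_exp, Complex.norm_exp]
  have hre : (g z).re ≤ 1000 * (p + 1) + (g z₀).re := by
    have := (Complex.abs_re_le_norm (g z - g z₀)).trans hbd
    rw [Complex.sub_re] at this
    linarith [le_abs_self ((g z).re - (g z₀).re)]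
  refine (Real.exp_le_exp.2 hre).trans ?_
  rw [Real.exp_add]
  gcongr
  unfold harnackConst
  have : Real.exp (1000 * ((p : ℝ) + 1)) = Real.exp 1 ^ (1000 * (p + 1)) := by
    rw [← Real.exp_nat_mul]; push_cast; ring_nf
  rw [this]
  push_cast
  gcongr
  linarith [Real.exp_one_lt_d9]

/-! ### Chains of discs and the doubling inequality -/

theorem IsPValentOn.norm_le_pow_of_segment {p : ℕ} {f : ℂ → ℂ} {D : Set ℂ} (hp : IsPValentOn p f D)
    (hf : DifferentiableOn ℂ f D) {c : ℝ} (hc : 0 < c) {w' : ℂ} (m : ℕ) : ∀ {w : ℂ},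
    (∀ u ∈ segment ℝ w w', ball u c ⊆ D ∧ ∀ z ∈ ball u c, f z ≠ 0) →
    dist w w' ≤ m * (c / 2) → ‖f w'‖ ≤ (harnackConst p : ℝ) ^ m * ‖f w‖ := by
  induction m with
  | zero =>
    intro w _ hd
    rw [Nat.cast_zero, zero_mul] at hd
    rw [dist_le_zero.1 hd, pow_zero, one_mul]
  | succ m ih =>
    intro w hseg hd
    -- With `m + 1` equal steps, each has length at most `c / 2` and stays in the half of a
    -- zero-free disc where Harnack applies.
    set w₁ := AffineMap.lineMap w w' (1 / (m + 1 : ℝ)) with hw₁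
    have hm : (0 : ℝ) < m + 1 := by positivity
    have h01 : (1 / (m + 1 : ℝ)) ∈ Icc (0 : ℝ) 1 :=
      ⟨by positivity, by rw [div_le_one hm]; linarith [(Nat.cast_nonneg m : (0 : ℝ) ≤ m)]⟩
    have hw₁mem : w₁ ∈ segment ℝ w w' := by
      rw [segment_eq_image_lineMap]; exact ⟨_, h01, rfl⟩
    push_cast at hd
    have hd1 : dist w₁ w ≤ c / 2 := by
      rw [hw₁, dist_lineMap_left, Real.norm_of_nonneg h01.1, one_div_mul_eq_div, div_le_iff₀ hm]
      linarith
    have hd2 : dist w₁ w' ≤ m * (c / 2) := by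
      rw [hw₁, dist_lineMap_right, Real.norm_of_nonneg (sub_nonneg.2 h01.2)]
      calc (1 - 1 / (m + 1 : ℝ)) * dist w w' ≤ (1 - 1 / (m + 1 : ℝ)) * ((m + 1) * (c / 2)) := by
            have := sub_nonneg.2 h01.2; gcongr
        _ = m * (c / 2) := by field_simp; ring
    have h1 := ih (fun u hu => hseg u ((convex_segment w w').segment_subset hw₁mem
      (right_mem_segment ℝ w w') hu)) hd2
    obtain ⟨hsub, hne⟩ := hseg w (left_mem_segment ℝ w w')
    have h2 := (hp.mono hsub).norm_le_of_ne_zero (hf.mono hsub) hne hc (mem_closedBall.2 hd1)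
    calc ‖f w'‖ ≤ (harnackConst p : ℝ) ^ m * ‖f w₁‖ := h1
      _ ≤ (harnackConst p : ℝ) ^ m * (harnackConst p * ‖f w‖) := by gcongr
      _ = _ := by ring

/-- Among equally spaced reals, more numerous than `F`, one is far from all elements of `F`. -/
theorem Finset.exists_forall_le_abs_sub (F : Finset ℝ) (α : ℝ) {c : ℝ} (hc : 0 < c) :
    ∃ s, α ≤ s ∧ s ≤ α + 2 * c * F.card ∧ ∀ x ∈ F, c ≤ |s - x| := by
  by_contra hcon
  push Not at hcon
  -- The spacing is `2 * c`, so an element of `F` is within `c` of at most one of these points.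
  have hj : ∀ j : Fin (F.card + 1), ∃ x ∈ F, |α + 2 * c * (j : ℕ) - x| < c := by
    intro j
    refine hcon _ (by have : 0 ≤ 2 * c * (j : ℕ) := by positivity
                      linarith) ?_
    have : ((j : ℕ) : ℝ) ≤ F.card := by exact_mod_cast Nat.le_of_lt_succ j.2
    gcongr
  choose x hxF hx using hj
  obtain ⟨j, -, k, -, hjk, hxx⟩ := Finset.exists_ne_map_eq_of_card_lt_of_maps_to
    (s := Finset.univ) (t := F) (f := x) (by simp) (fun j _ => hxF j)
  refine hjk (Fin.ext ?_)
  have h1 := abs_lt.1 (hx j)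
  have h2 := abs_lt.1 (hx k)
  rw [hxx] at h1
  have h3 : ((j : ℕ) : ℝ) < (k : ℕ) + 1 := by nlinarith
  have h4 : ((k : ℕ) : ℝ) < (j : ℕ) + 1 := by nlinarith
  have h5 : (j : ℕ) < k + 1 := by exact_mod_cast h3
  have h6 : (k : ℕ) < j + 1 := by exact_mod_cast h4
  omega

/-- The constant in the doubling inequality for `p`-valent functions. -/
def doublingConst (p : ℕ) : ℕ := harnackConst p ^ (400 * (2 * p + 1))

theorem one_le_doublingConst (p : ℕ) : 1 ≤ doublingConst p :=
  Nat.one_le_pow _ _ (one_le_harnackConst p)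

attribute [irreducible] doublingConst

theorem IsPValentOn.finite_zeros {p : ℕ} {f : ℂ → ℂ} {D : Set ℂ} (hp : IsPValentOn p f D) :
    ∃ Z : Finset ℂ, Z.card ≤ p ∧ ∀ z, z ∈ Z ↔ z ∈ D ∧ f z = 0 := by
  have hfin : {z ∈ D | f z = 0}.Finite := finite_of_encard_le_coe (hp 0)
  refine ⟨hfin.toFinset, ?_, fun z => by simp⟩
  have := hp 0
  rw [hfin.encard_eq_coe_toFinset_card] at this
  exact_mod_cast this

/-- The maximum principle on a square inside the unit disc. -/
theorem norm_le_of_forall_norm_le_on_square {f : ℂ → ℂ} {s C : ℝ} (hs0 : 1 / 2 ≤ s)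
    (hs1 : s ≤ 11 / 20) (hf : DifferentiableOn ℂ f (ball 0 1))
    (hC : ∀ x y : ℝ, |x| ≤ s → |y| ≤ s → (|x| = s ∨ |y| = s) → ‖f ⟨x, y⟩‖ ≤ C)
    {z : ℂ} (hz : z ∈ closedBall (0 : ℂ) (1 / 2)) : ‖f z‖ ≤ C := by
  have hs00 : |s| = s := abs_of_nonneg (by linarith)
  have hsn : |-s| = s := by rw [abs_neg, hs00]
  have hss : -s ≠ s := by intro h; linarith
  have hclos : closure (Ioo (-s) s ×ℂ Ioo (-s) s) = Icc (-s) s ×ℂ Icc (-s) s := by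
    rw [Complex.closure_reProdIm, closure_Ioo hss]
  have hsubset : Icc (-s) s ×ℂ Icc (-s) s ⊆ ball (0 : ℂ) 1 := by
    rintro u ⟨⟨h1, h2⟩, ⟨h3, h4⟩⟩
    rw [mem_ball, dist_zero_right]
    refine abs_lt_of_sq_lt_sq' ?_ (by norm_num) |>.2
    rw [← Complex.normSq_eq_norm_sq, Complex.normSq_apply]
    nlinarith
  refine Complex.norm_le_of_forall_mem_frontier_norm_le
    ((isBounded_Ioo (-s) s).reProdIm (isBounded_Ioo (-s) s))
    (DifferentiableOn.diffContOnCl (by rw [hclos]; exact hf.mono hsubset)) ?_ ?_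
  · rintro ⟨x, y⟩ hu
    rw [Complex.frontier_reProdIm, closure_Ioo hss, frontier_Ioo (by linarith)] at hu
    have key : ∀ t ∈ ({-s, s} : Set ℝ), |t| = s := by
      rintro t (rfl | rfl) <;> assumption
    rcases hu with ⟨h1, h2⟩ | ⟨h1, h2⟩
    · exact hC x y (abs_le.2 h1) (key _ h2).le (Or.inr (key _ h2))
    · exact hC x y (key _ h1).le (abs_le.2 h2) (Or.inl (key _ h1))
  · rw [hclos]
    rw [mem_closedBall, dist_zero_right] at hz
    exact ⟨abs_le.1 (((Complex.abs_re_le_norm z).trans hz).trans hs0),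
      abs_le.1 (((Complex.abs_im_le_norm z).trans hz).trans hs0)⟩

/-- A horizontal line meeting the small disc and the boundary of a square around the half disc can
both be kept at distance `c` from all zeros. Harnack chains carry the bound along the line and
around the boundary, and the maximum principle carries it inside. -/
theorem IsPValentOn.norm_le_doublingConst_unit {p : ℕ} {f : ℂ → ℂ}
    (hp : IsPValentOn p f (ball 0 1)) (hf : DifferentiableOn ℂ f (ball 0 1)) {M : ℝ}
    (hM : ∀ z ∈ closedBall (0 : ℂ) (1 / 16), ‖f z‖ ≤ M) {z : ℂ}
    (hz : z ∈ closedBall (0 : ℂ) (1 / 2)) :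
    ‖f z‖ ≤ doublingConst p * M := by
  obtain ⟨Z, hZp, hZ⟩ := hp.finite_zeros
  have hp0 : (0 : ℝ) ≤ p := Nat.cast_nonneg p
  -- The line avoids at most `p` heights and the square at most `2 * p` values, so steps of `2 * c`
  -- keep `τ ≤ 1/40` and `s ≤ 11/20`.
  set c : ℝ := 1 / (40 * (2 * p + 1)) with hcdef
  have hc : 0 < c := by positivity
  have hcp : c * (40 * (2 * p + 1)) = 1 := by rw [hcdef]; field_simp
  have hZp' : (Z.card : ℝ) ≤ p := by exact_mod_cast hZp
  obtain ⟨τ, hτ0, hτ1, hτ⟩ := (Z.image Complex.im).exists_forall_le_abs_sub 0 hc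
  obtain ⟨s, hs0, hs1, hs⟩ := (Z.image (fun z => |z.re|) ∪
    Z.image (fun z => |z.im|)).exists_forall_le_abs_sub (1 / 2) hc
  have hτle : τ ≤ 1 / 40 := by
    have : ((Z.image Complex.im).card : ℝ) ≤ p :=
      le_trans (by exact_mod_cast Finset.card_image_le) hZp'
    nlinarith
  have hsle : s ≤ 11 / 20 := by
    have : ((Z.image (fun z => |z.re|) ∪ Z.image (fun z => |z.im|)).card : ℝ) ≤ p + p :=
      calc _ ≤ ((Z.image (fun z => |z.re|)).card : ℝ) + (Z.image (fun z => |z.im|)).card := by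
            exact_mod_cast Finset.card_union_le _ _
        _ ≤ Z.card + Z.card := by
            gcongr <;> exact_mod_cast Finset.card_image_le
        _ ≤ p + p := by gcongr
    nlinarith
  have hc40 : c ≤ 1 / 40 := by nlinarith
  have hclear : ∀ u : ℂ, |u.re| ≤ s → |u.im| ≤ s → (u.im = τ ∨ |u.re| = s ∨ |u.im| = s) →
      ball u c ⊆ ball 0 1 ∧ ∀ z ∈ ball u c, f z ≠ 0 := by
    intro u hre him hor
    have hsub : ball u c ⊆ ball 0 1 := by
      refine ball_subset_ball' ?_
      rw [dist_zero_right]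
      have : ‖u‖ ≤ 9 / 10 := by
        refine abs_le_of_sq_le_sq' ?_ (by norm_num) |>.2
        rw [← Complex.normSq_eq_norm_sq, Complex.normSq_apply]
        have h1 := abs_le.1 hre
        have h2 := abs_le.1 him
        nlinarith
      linarith
    refine ⟨hsub, fun z hz hz0 => ?_⟩
    have hzZ : z ∈ Z := (hZ z).2 ⟨hsub hz, hz0⟩
    rw [mem_ball', dist_eq_norm] at hz
    have hzre := (Complex.abs_re_le_norm (u - z)).trans_lt hz
    have hzim := (Complex.abs_im_le_norm (u - z)).trans_lt hz
    rw [Complex.sub_re] at hzre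
    rw [Complex.sub_im] at hzim
    rcases hor with h | h | h
    · have := hτ z.im (Finset.mem_image_of_mem _ hzZ)
      rw [← h] at this; linarith
    · have := hs |z.re| (Finset.mem_union_left _ (Finset.mem_image_of_mem (fun z => |z.re|) hzZ))
      rw [← h] at this
      linarith [abs_abs_sub_abs_le u.re z.re]
    · have := hs |z.im| (Finset.mem_union_right _ (Finset.mem_image_of_mem (fun z => |z.im|) hzZ))
      rw [← h] at this
      linarith [abs_abs_sub_abs_le u.im z.im]
  obtain ⟨K, hK⟩ : ∃ K : ℝ, K = (harnackConst p : ℝ) ^ (100 * (2 * p + 1)) := ⟨_, rfl⟩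
  have hK1 : 1 ≤ K := hK ▸ one_le_pow₀ (by exact_mod_cast one_le_harnackConst p)
  have hstep : ∀ a b a' b' : ℝ, |a| ≤ s → |b| ≤ s → |a'| ≤ s → |b'| ≤ s →
      ((b = b' ∧ (b = τ ∨ |b| = s)) ∨ (a = a' ∧ |a| = s)) →
      ‖f ⟨a', b'⟩‖ ≤ K * ‖f ⟨a, b⟩‖ := by
    intro a b a' b' ha hb ha' hb' hor
    rw [hK]
    refine hp.norm_le_pow_of_segment hf hc _ ?_ ?_
    · intro u hu
      obtain ⟨x, y, hx, hy, hxy, rfl⟩ := hu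
      have hre : ((x : ℝ) • (⟨a, b⟩ : ℂ) + (y : ℝ) • (⟨a', b'⟩ : ℂ)).re = x * a + y * a' := by simp
      have him : ((x : ℝ) • (⟨a, b⟩ : ℂ) + (y : ℝ) • (⟨a', b'⟩ : ℂ)).im = x * b + y * b' := by simp
      have key : ∀ v v' : ℝ, |v| ≤ s → |v'| ≤ s → |x * v + y * v'| ≤ s := by
        intro v v' hv hv'
        rw [abs_le] at hv hv' ⊢
        have : s = x * s + y * s := by rw [← add_mul, hxy, one_mul]
        constructor <;> nlinarith
      refine hclear _ (by rw [hre]; exact key _ _ ha ha') (by rw [him]; exact key _ _ hb hb') ?_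
      rw [hre, him]
      rcases hor with ⟨rfl, h⟩ | ⟨rfl, h⟩
      · rw [← add_mul, hxy, one_mul]; tauto
      · rw [← add_mul, hxy, one_mul]; tauto
    · have hm : ((100 * (2 * p + 1) : ℕ) : ℝ) * (c / 2) = 5 / 4 := by push_cast; linarith
      rw [hm, dist_eq_norm]
      refine (Complex.norm_le_abs_re_add_abs_im _).trans ?_
      simp only [Complex.sub_re, Complex.sub_im]
      rw [abs_le] at ha hb ha' hb'
      rcases hor with ⟨rfl, -⟩ | ⟨rfl, -⟩
      · rw [sub_self, abs_zero, add_zero, abs_le]; constructor <;> linarith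
      · rw [sub_self, abs_zero, zero_add, abs_le]; constructor <;> linarith
  have hM0 : 0 ≤ M := (norm_nonneg _).trans (hM 0 (mem_closedBall_self (by norm_num)))
  have hs00 : |s| = s := abs_of_nonneg (by linarith)
  have hsn : |-s| = s := by rw [abs_neg, hs00]
  have hτs : |τ| ≤ s := by rw [abs_of_nonneg hτ0]; linarith
  have hstart : ‖f ⟨0, τ⟩‖ ≤ M := by
    refine hM _ ?_
    rw [mem_closedBall, dist_zero_right]
    refine (Complex.norm_le_abs_re_add_abs_im _).trans ?_
    simp only [abs_zero, abs_of_nonneg hτ0]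
    linarith
  have hmono : ∀ x : ℝ, 0 ≤ x → x ≤ K * x := fun x hx => le_mul_of_one_le_left hx hK1
  -- The route runs from `τ * I` to the right side, then along the horizontal sides to the left
  -- side. At most four segments are used, each costing a factor `K`.
  have hright : ∀ y : ℝ, |y| ≤ s → ‖f ⟨s, y⟩‖ ≤ K * (K * M) := by
    intro y hy
    calc _ ≤ K * ‖f ⟨s, τ⟩‖ := hstep s τ s y hs00.le hτs hs00.le hy (Or.inr ⟨rfl, hs00⟩)
      _ ≤ K * (K * ‖f ⟨0, τ⟩‖) := by
          gcongr
          exact hstep 0 τ s τ (by simp; linarith) hτs hs00.le hτs (Or.inl ⟨rfl, Or.inl rfl⟩)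
      _ ≤ K * (K * M) := by gcongr
  have htop : ∀ x y : ℝ, |x| ≤ s → |y| = s → ‖f ⟨x, y⟩‖ ≤ K * (K * (K * M)) := by
    intro x y hx hy
    calc _ ≤ K * ‖f ⟨s, y⟩‖ := hstep s y x y hs00.le hy.le hx hy.le (Or.inl ⟨rfl, Or.inr hy⟩)
      _ ≤ _ := by gcongr; exact hright y hy.le
  have hleft : ∀ y : ℝ, |y| ≤ s → ‖f ⟨-s, y⟩‖ ≤ K * (K * (K * (K * M))) := by
    intro y hy
    calc _ ≤ K * ‖f ⟨-s, s⟩‖ := hstep (-s) s (-s) y hsn.le hs00.le hsn.le hy (Or.inr ⟨rfl, hsn⟩)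
      _ ≤ _ := by gcongr; exact htop _ _ hsn.le hs00
  have hK4 : (doublingConst p : ℝ) * M = K * (K * (K * (K * M))) := by
    have : (doublingConst p : ℝ) = K ^ 4 := by
      unfold doublingConst
      rw [hK, Nat.cast_pow, ← pow_mul]
      congr 1
      ring
    rw [this]; ring
  rw [hK4]
  refine norm_le_of_forall_norm_le_on_square hs0 hsle hf ?_ hz
  intro x y hx hy hxy
  rcases hxy with h | h
  · rcases (abs_eq (hs00 ▸ abs_nonneg s)).1 h with rfl | rfl
    · exact (hright y hy).trans ((hmono _ (by positivity)).trans (hmono _ (by positivity)))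
    · exact hleft y hy
  · exact (htop x y hx h).trans (hmono _ (by positivity))

/-- A doubling inequality for `p`-valent functions. -/
theorem IsPValentOn.norm_le_doublingConst {p : ℕ} {f : ℂ → ℂ} {a : ℂ} {r : ℝ} (hr : 0 < r)
    (hp : IsPValentOn p f (ball a r)) (hf : DifferentiableOn ℂ f (ball a r)) {M : ℝ}
    (hM : ∀ z ∈ closedBall a (r / 16), ‖f z‖ ≤ M) {z : ℂ} (hz : z ∈ closedBall a (r / 2)) :
    ‖f z‖ ≤ doublingConst p * M := by
  have hr' : (r : ℂ) ≠ 0 := by exact_mod_cast hr.ne'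
  have hdist : ∀ w : ℂ, dist (a + r * w) a = r * ‖w‖ := by
    intro w; rw [dist_eq_norm, add_sub_cancel_left, norm_mul, Complex.norm_of_nonneg hr.le]
  have hmaps : MapsTo (fun w : ℂ => a + r * w) (ball 0 1) (ball a r) := by
    intro w hw
    rw [mem_ball, dist_zero_right] at hw
    rw [mem_ball, hdist]
    nlinarith
  have hinj : Function.Injective (fun w : ℂ => a + r * w) := fun x y h =>
    mul_left_cancel₀ hr' (add_left_cancel h)
  have hp' : IsPValentOn p (fun w => f (a + r * w)) (ball 0 1) := by
    intro w
    rw [← hinj.encard_image]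
    refine (encard_le_encard ?_).trans (hp w)
    rintro _ ⟨y, ⟨hy, hyw⟩, rfl⟩
    exact ⟨hmaps hy, hyw⟩
  have hz' : a + r * ((z - a) / r) = z := by field_simp; ring
  have := hp'.norm_le_doublingConst_unit (M := M) (z := (z - a) / r)
    (hf.comp (by fun_prop) hmaps) (fun w hw => hM _ (by
      rw [mem_closedBall, dist_zero_right] at hw
      rw [mem_closedBall, hdist]; nlinarith)) (by
      rw [mem_closedBall, dist_eq_norm] at hz
      rw [mem_closedBall, dist_zero_right, norm_div, Complex.norm_of_nonneg hr.le,
        div_le_iff₀ hr]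
      linarith)
  rwa [hz'] at this

/-! ### Covering the sublevel set by discs of controlled growth -/

/-- A disc of radius `ρ` splits into `(m + 1) ^ 2` cells of diameter at most `4 * ρ / m`. -/
theorem exists_cells (a : ℂ) {ρ : ℝ} (hρ : 0 < ρ) {m : ℕ} (hm : 0 < m) :
    ∃ (ι : Type) (_ : Fintype ι) (q : ℂ → ι), Fintype.card ι = (m + 1) ^ 2 ∧
      ∀ x ∈ closedBall a ρ, ∀ y ∈ closedBall a ρ, q x = q y → dist x y ≤ 4 * ρ / m := by
  have hm' : (0 : ℝ) < m := by exact_mod_cast hm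
  -- The extra slot takes the right endpoint, where the floor equals `m`; on `[-ρ, ρ]` the reduction
  -- modulo `m + 1` never acts.
  let φ : ℝ → Fin (m + 1) := fun t => Fin.ofNat (m + 1) ⌊(t + ρ) * (m / (2 * ρ))⌋₊
  have hφ : ∀ s t : ℝ, |s| ≤ ρ → |t| ≤ ρ → φ s = φ t → |s - t| ≤ 2 * ρ / m := by
    intro s t hs ht hst
    have hpos : 0 < (m : ℝ) / (2 * ρ) := by positivity
    have hfl : ∀ u : ℝ, |u| ≤ ρ → 0 ≤ (u + ρ) * (m / (2 * ρ)) ∧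
        ⌊(u + ρ) * (m / (2 * ρ))⌋₊ < m + 1 := by
      intro u hu
      rw [abs_le] at hu
      refine ⟨mul_nonneg (by linarith) hpos.le, Nat.lt_succ_of_le (Nat.floor_le_of_le ?_)⟩
      calc (u + ρ) * (m / (2 * ρ)) ≤ (2 * ρ) * (m / (2 * ρ)) := by gcongr; linarith
        _ = m := by field_simp
    have h := congrArg Fin.val hst
    simp only [φ, Fin.val_ofNat, Nat.mod_eq_of_lt (hfl s hs).2, Nat.mod_eq_of_lt (hfl t ht).2] at h
    have h1 := Nat.floor_le (hfl s hs).1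
    have h2 := Nat.floor_le (hfl t ht).1
    have h3 := Nat.lt_floor_add_one ((s + ρ) * (m / (2 * ρ)))
    have h4 := Nat.lt_floor_add_one ((t + ρ) * (m / (2 * ρ)))
    rw [h] at h1 h3
    have h5 : |s - t| * (m / (2 * ρ)) ≤ 1 := by
      have habs : |s - t| * (m / (2 * ρ)) = |(s - t) * (m / (2 * ρ))| := by
        rw [abs_mul, abs_of_pos hpos]
      rw [habs, abs_le]
      constructor <;> nlinarith
    calc |s - t| = |s - t| * (m / (2 * ρ)) * (2 * ρ / m) := by field_simp
      _ ≤ 1 * (2 * ρ / m) := by gcongr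
      _ = _ := one_mul _
  refine ⟨Fin (m + 1) × Fin (m + 1), inferInstance, fun z => (φ (z - a).re, φ (z - a).im),
    by simp [sq], fun x hx y hy hxy => ?_⟩
  rw [mem_closedBall, dist_eq_norm] at hx hy
  obtain ⟨h1, h2⟩ := Prod.ext_iff.1 hxy
  have h3 := hφ _ _ ((Complex.abs_re_le_norm _).trans hx) ((Complex.abs_re_le_norm _).trans hy) h1
  have h4 := hφ _ _ ((Complex.abs_im_le_norm _).trans hx) ((Complex.abs_im_le_norm _).trans hy) h2
  rw [dist_eq_norm]
  refine (Complex.norm_le_abs_re_add_abs_im _).trans ?_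
  simp only [Complex.sub_re, Complex.sub_im, sub_sub_sub_cancel_right] at h3 h4 ⊢
  calc _ ≤ 2 * ρ / m + 2 * ρ / m := add_le_add h3 h4
    _ = _ := by ring

/-- There is a largest disc around a zero of `f` on which `f` is bounded by `A`. -/
theorem exists_maximal_ball_norm_le {f : ℂ → ℂ} {a ζ : ℂ} {r A : ℝ} (hr : 0 < r)
    (hf : ContinuousOn f (ball a r)) (hζ : ζ ∈ ball a r) (hfζ : f ζ = 0) (hA : 0 < A) :
    ∃ R, 0 < R ∧ ball ζ R ⊆ ball a r ∧ (∀ z ∈ ball ζ R, ‖f z‖ ≤ A) ∧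
      ∀ R' ≤ r, ball ζ R' ⊆ ball a r → (∀ z ∈ ball ζ R', ‖f z‖ ≤ A) → R' ≤ R := by
  set S : Set ℝ := {R' | R' ≤ r ∧ ball ζ R' ⊆ ball a r ∧ ∀ z ∈ ball ζ R', ‖f z‖ ≤ A} with hS
  have hbdd : BddAbove S := ⟨r, fun _ h => h.1⟩
  obtain ⟨δ, hδ0, hδS⟩ : ∃ δ, 0 < δ ∧ δ ∈ S := by
    have h1 := hf.continuousAt (isOpen_ball.mem_nhds hζ)
    have h2 : ∀ᶠ z in nhds ζ, ‖f z‖ < A :=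
      h1.norm.eventually_lt continuousAt_const (by simpa [hfζ] using hA)
    obtain ⟨δ, hδ, h⟩ := Metric.eventually_nhds_iff_ball.1 (h2.and (isOpen_ball.mem_nhds hζ))
    have hle : ball ζ (min δ r) ⊆ ball ζ δ := ball_subset_ball (min_le_left _ _)
    exact ⟨min δ r, lt_min hδ hr, min_le_right _ _, fun z hz => (h z (hle hz)).2,
      fun z hz => (h z (hle hz)).1.le⟩
  have hex : ∀ z ∈ ball ζ (sSup S), ∃ R' ∈ S, z ∈ ball ζ R' := fun z hz =>
    exists_lt_of_lt_csSup ⟨δ, hδS⟩ hz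
  refine ⟨sSup S, lt_of_lt_of_le hδ0 (le_csSup hbdd hδS), fun z hz => ?_, fun z hz => ?_,
    fun R' h1 h2 h3 => le_csSup hbdd ⟨h1, h2, h3⟩⟩
  · obtain ⟨R', hR', hz'⟩ := hex z hz
    exact hR'.2.1 hz'
  · obtain ⟨R', hR', hz'⟩ := hex z hz
    exact hR'.2.2 z hz'

/-- The factor by which a `p`-valent function can exceed `H` on the discs covering the set where
it is at most `H`. -/
def growthConst (p : ℕ) : ℕ := doublingConst p * harnackConst p

theorem one_le_growthConst (p : ℕ) : 1 ≤ growthConst p :=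
  Nat.mul_pos (one_le_doublingConst p) (one_le_harnackConst p)

attribute [irreducible] growthConst

/-- The sublevel set `‖f‖ ≤ H` of a `p`-valent function is covered by boundedly many discs on the
doubles of which `‖f‖ ≤ growthConst p * H`. -/
theorem IsPValentOn.exists_cover {p : ℕ} {f : ℂ → ℂ} {a : ℂ} {r H : ℝ} (hr : 0 < r) (hH : 0 < H)
    (hp : IsPValentOn p f (ball a r)) (hf : DifferentiableOn ℂ f (ball a r)) :
    ∃ F : Finset (ℂ × ℝ), F.card ≤ 129 ^ 2 + p ∧
      (∀ b ∈ F, 0 < b.2 ∧ ball b.1 b.2 ⊆ ball a r ∧ ∀ z ∈ ball b.1 b.2, ‖f z‖ ≤ growthConst p * H) ∧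
      ∀ z ∈ closedBall a (r / 2), ‖f z‖ ≤ H → ∃ b ∈ F, z ∈ closedBall b.1 (b.2 / 2) := by
  classical
  have hK0 : (0 : ℝ) ≤ harnackConst p := Nat.cast_nonneg _
  have hD1 : (1 : ℝ) ≤ doublingConst p := by exact_mod_cast one_le_doublingConst p
  have hA : (growthConst p : ℝ) * H = doublingConst p * (harnackConst p * H) := by
    unfold growthConst
    rw [Nat.cast_mul, mul_assoc]
  have hKA : harnackConst p * H ≤ growthConst p * H := by
    rw [hA]; exact le_mul_of_one_le_left (by positivity) hD1
  obtain ⟨A, hAdef⟩ : ∃ A, A = growthConst p * H := ⟨_, rfl⟩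
  obtain ⟨K, hK⟩ : ∃ K : ℝ, K = harnackConst p := ⟨_, rfl⟩
  obtain ⟨E, hE⟩ : ∃ E : ℝ, E = doublingConst p := ⟨_, rfl⟩
  have hApos : 0 < A := by
    have : (1 : ℝ) ≤ growthConst p := by exact_mod_cast one_le_growthConst p
    rw [hAdef]; positivity
  rw [← hK] at hK0
  rw [← hAdef, ← hK] at hKA
  rw [← hAdef, ← hK, ← hE] at hA
  rw [← hAdef]
  obtain ⟨Z, hZp, hZ⟩ := hp.finite_zeros
  have hrad : ∀ ζ, ∃ R, ζ ∈ Z → 0 < R ∧ ball ζ R ⊆ ball a r ∧ (∀ z ∈ ball ζ R, ‖f z‖ ≤ A) ∧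
      ∀ R' ≤ r, ball ζ R' ⊆ ball a r → (∀ z ∈ ball ζ R', ‖f z‖ ≤ A) → R' ≤ R := by
    intro ζ
    by_cases hζ : ζ ∈ Z
    · obtain ⟨R, hR⟩ := exists_maximal_ball_norm_le hr hf.continuousOn ((hZ ζ).1 hζ).1
        ((hZ ζ).1 hζ).2 hApos
      exact ⟨R, fun _ => hR⟩
    · exact ⟨0, fun h => absurd h hζ⟩
  choose R hR using hrad
  -- Cells have diameter at most `r / 64`, so the half-radius disc around any representative, of
  -- radius `r / 64`, covers its cell.
  obtain ⟨ι, _, q, hcard, hq⟩ := exists_cells a (half_pos hr) (m := 128) (by norm_num)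
  let G : Set ℂ := {z | z ∈ closedBall a (r / 2) ∧ ∀ w ∈ ball z (r / 32), ‖f w‖ ≤ A}
  have hrep : ∀ i, ∃ w, (∃ z ∈ G, q z = i) → w ∈ G ∧ q w = i := by
    intro i
    by_cases h : ∃ z ∈ G, q z = i
    · obtain ⟨z, hz⟩ := h
      exact ⟨z, fun _ => hz⟩
    · exact ⟨0, fun h' => absurd h' h⟩
  choose w hw using hrep
  refine ⟨(Finset.univ.filter fun i => ∃ z ∈ G, q z = i).image (fun i => (w i, r / 32)) ∪
    Z.image (fun ζ => (ζ, R ζ)), ?_, ?_, ?_⟩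
  · refine (Finset.card_union_le _ _).trans (add_le_add ?_ (Finset.card_image_le.trans hZp))
    refine Finset.card_image_le.trans ((Finset.card_filter_le _ _).trans ?_)
    rw [Finset.card_univ, hcard]
  · intro b hb
    rcases Finset.mem_union.1 hb with h | h
    · obtain ⟨i, hi, rfl⟩ := Finset.mem_image.1 h
      obtain ⟨hG, -⟩ := hw i (Finset.mem_filter.1 hi).2
      refine ⟨by positivity, ball_subset_ball' ?_, hG.2⟩
      have := mem_closedBall.1 hG.1
      change r / 32 + dist (w i) a ≤ r
      linarith
    · obtain ⟨ζ, hζ, rfl⟩ := Finset.mem_image.1 h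
      obtain ⟨h1, h2, h3, -⟩ := hR ζ hζ
      exact ⟨h1, h2, h3⟩
  · intro z hz hfz
    have hza := mem_closedBall.1 hz
    by_cases hzero : ∀ ζ ∈ Z, r / 16 ≤ dist z ζ
    · have hsub : ball z (r / 16) ⊆ ball a r := ball_subset_ball' (by linarith)
      have hzG : z ∈ G := by
        refine ⟨hz, fun y hy => ?_⟩
        have := (hp.mono hsub).norm_le_of_ne_zero (hf.mono hsub) (fun x hx hx0 => by
          have h1 := hzero x ((hZ x).2 ⟨hsub hx, hx0⟩)
          rw [mem_ball, dist_comm] at hx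
          linarith) (by positivity) (z := y)
          (by rw [mem_ball] at hy; rw [mem_closedBall]; linarith)
        rw [← hK] at this
        exact this.trans (le_trans (by gcongr) hKA)
      obtain ⟨h1, h2⟩ := hw (q z) ⟨z, hzG, rfl⟩
      refine ⟨(w (q z), r / 32), Finset.mem_union_left _ (Finset.mem_image_of_mem _
        (Finset.mem_filter.2 ⟨Finset.mem_univ _, z, hzG, rfl⟩)), ?_⟩
      have := hq z hz _ h1.1 h2.symm
      rw [mem_closedBall]
      refine this.trans (le_of_eq ?_)
      push_cast
      ring
    · push Not at hzero
      obtain ⟨ζ₀, hζ₀, hd₀⟩ := hzero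
      obtain ⟨ζ, hζ, hmin⟩ := Z.exists_min_image (fun ζ => dist z ζ) ⟨ζ₀, hζ₀⟩
      have hlt : dist z ζ < r / 16 := (hmin ζ₀ hζ₀).trans_lt hd₀
      refine ⟨(ζ, R ζ), Finset.mem_union_right _ (Finset.mem_image_of_mem _ hζ), ?_⟩
      obtain ⟨hR0, -, -, hRmax⟩ := hR ζ hζ
      rw [mem_closedBall]
      change dist z ζ ≤ R ζ / 2
      set t := dist z ζ with ht
      rcases (dist_nonneg : 0 ≤ dist z ζ).eq_or_lt with h0 | h0
      · rw [ht, ← h0]; positivity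
      rw [← ht] at h0
      -- The disc of radius `t` about `z` has no zeros, so Harnack bounds `f` on its half, which is
      -- a sixteenth of this larger disc. Doubling extends the bound to radius `4 * t` about `z`,
      -- which contains the disc of radius `3 * t` about `ζ`; maximality gives `R ζ ≥ 3 * t`.
      have hsub8 : ball z (8 * t) ⊆ ball a r := ball_subset_ball' (by linarith)
      have hsub1 : ball z t ⊆ ball a r := (ball_subset_ball (by linarith)).trans hsub8
      have hK1 : ∀ y ∈ closedBall z (8 * t / 16), ‖f y‖ ≤ K * H := by
        intro y hy
        have := (hp.mono hsub1).norm_le_of_ne_zero (hf.mono hsub1) (fun x hx hx0 => by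
          have h1 := hmin x ((hZ x).2 ⟨hsub1 hx, hx0⟩)
          rw [mem_ball, dist_comm] at hx
          linarith) h0 (z := y) (by convert hy using 2; ring)
        rw [← hK] at this
        exact this.trans (by gcongr)
      have hdbl : ∀ y ∈ closedBall z (8 * t / 2), ‖f y‖ ≤ A := by
        intro y hy
        rw [hA, hE]
        exact (hp.mono hsub8).norm_le_doublingConst (by positivity) (hf.mono hsub8) hK1 hy
      have h4 : ball ζ (3 * t) ⊆ closedBall z (8 * t / 2) :=
        (ball_subset_ball' (by rw [dist_comm, ← ht]; linarith : 3 * t + dist ζ z ≤ 8 * t / 2)).trans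
          ball_subset_closedBall
      have h5 : ball ζ (3 * t) ⊆ ball a r :=
        (ball_subset_ball' (by rw [dist_comm, ← ht]; linarith)).trans hsub8
      have := hRmax (3 * t) (by linarith) h5 (fun y hy => hdbl y (h4 hy))
      linarith

/-! ### Siegel's lemma, Taylor estimates and Liouville's inequality -/

/-- Pigeonhole: complex vectors have a small nontrivial integer combination. -/
theorem exists_int_combination_norm_le {ι : Type*} [Fintype ι] {L T : ℕ} (hL : 0 < L) (hT : 0 < T)
    (hι : Fintype.card ι = 4 * L) {G η : ℝ} (hG : 0 < G) (v : ι → Fin L → ℂ)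
    (hv : ∀ i n, ‖v i n‖ ≤ G) (hTη : 4 * (4 * L) * G ≤ η * T) :
    ∃ c : ι → ℤ, c ≠ 0 ∧ (∀ i, |c i| ≤ T) ∧ ∀ n, ‖∑ i, (c i : ℂ) * v i n‖ ≤ η := by
  classical
  have hT' : (0 : ℝ) < T := by exact_mod_cast hT
  have hL' : (0 : ℝ) < L := by exact_mod_cast hL
  have hρ : (0 : ℝ) < 4 * L * (T * G) := by positivity
  obtain ⟨κ, _, q, hcard, hq⟩ := exists_cells 0 hρ (m := T ^ 2) (by positivity)
  let s : (ι → Fin (T + 1)) → Fin L → ℂ := fun c n => ∑ i, ((c i : ℕ) : ℂ) * v i n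
  have hs : ∀ c n, s c n ∈ closedBall (0 : ℂ) (4 * L * (T * G)) := by
    intro c n
    rw [mem_closedBall, dist_zero_right]
    calc ‖s c n‖ ≤ ∑ i : ι, (T : ℝ) * G := by
          refine norm_sum_le_of_le _ fun i _ => ?_
          rw [norm_mul, Complex.norm_natCast]
          have : ((c i : ℕ) : ℝ) ≤ T := by exact_mod_cast Nat.le_of_lt_succ (c i).2
          exact mul_le_mul this (hv i n) (norm_nonneg _) hT'.le
      _ = 4 * L * (T * G) := by
          rw [Finset.sum_const, Finset.card_univ, hι, nsmul_eq_mul]; push_cast; ring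
  -- There are twice as many unknowns as real equations, so about `T ^ 2` slots per real coordinate
  -- are affordable. This makes the cell diameter at most `16 * L * G / T`.
  have hlt : Fintype.card (Fin L → κ) < Fintype.card (ι → Fin (T + 1)) := by
    rw [Fintype.card_fun, Fintype.card_fun, hcard, hι, Fintype.card_fin, Fintype.card_fin, pow_mul]
    refine Nat.pow_lt_pow_left ?_ hL.ne'
    calc (T ^ 2 + 1) ^ 2 < ((T + 1) ^ 2) ^ 2 := Nat.pow_lt_pow_left (by nlinarith) (by norm_num)
      _ = (T + 1) ^ 4 := by ring
  obtain ⟨c, c', hne, heq⟩ := Fintype.exists_ne_map_eq_of_card_lt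
    (fun (c : ι → Fin (T + 1)) n => q (s c n)) hlt
  refine ⟨fun i => ((c i : ℕ) : ℤ) - ((c' i : ℕ) : ℤ), ?_, fun i => ?_, fun n => ?_⟩
  · intro h0
    refine hne (funext fun i => Fin.ext ?_)
    have := congrFun h0 i
    simp only [Pi.zero_apply] at this
    omega
  · have h1 := (c i).2
    have h2 := (c' i).2
    beta_reduce
    rw [abs_le]
    constructor <;> omega
  · have h := hq _ (hs c n) _ (hs c' n) (congrFun heq n)
    rw [dist_eq_norm] at h
    have hsum : ∑ i, ((((c i : ℕ) : ℤ) - ((c' i : ℕ) : ℤ) : ℤ) : ℂ) * v i n = s c n - s c' n := by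
      simp only [s]
      rw [← Finset.sum_sub_distrib]
      refine Finset.sum_congr rfl fun i _ => ?_
      push_cast
      ring
    rw [hsum]
    refine h.trans ?_
    push_cast
    rw [div_le_iff₀ (by positivity)]
    calc 4 * (4 * L * (T * G)) = (4 * (4 * L) * G) * T := by ring
      _ ≤ η * T * T := by gcongr
      _ = η * (T : ℝ) ^ 2 := by ring

/-- A function with small Taylor coefficients up to order `L` is small near the centre. -/
theorem norm_le_of_taylorCoeff_le {h : ℂ → ℂ} {z₀ z : ℂ} {R N η σ : ℝ} {L : ℕ} (hR : 0 < R)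
    (hh : DifferentiableOn ℂ h (closedBall z₀ R)) (hN : ∀ z ∈ closedBall z₀ R, ‖h z‖ ≤ N)
    (hη : ∀ n < L, ‖(R : ℂ) ^ n * (n.factorial : ℂ)⁻¹ * iteratedDeriv n h z₀‖ ≤ η) (hη0 : 0 ≤ η)
    (hσ0 : 0 ≤ σ) (hσ1 : σ ≤ 1) (hz : dist z z₀ ≤ σ * R / 2) :
    ‖h z‖ ≤ 2 * η + 2 * N * σ ^ L := by
  have hR' : (R : ℂ) ≠ 0 := by exact_mod_cast hR.ne'
  have hN0 : 0 ≤ N := (norm_nonneg _).trans (hN z₀ (mem_closedBall_self hR.le))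
  have hzb : z ∈ ball z₀ R := by rw [mem_ball]; nlinarith
  have hsum := Complex.hasSum_taylorSeries_on_ball (hh.mono ball_subset_closedBall) hzb
  have hg : HasSum (fun n : ℕ => (η + N * σ ^ L) * (1 / 2 : ℝ) ^ n) ((η + N * σ ^ L) * 2) :=
    hasSum_geometric_two.mul_left _
  refine (hsum.norm_le_of_bounded hg fun n => ?_).trans (le_of_eq (by ring))
  have hdc : DiffContOnCl ℂ h (ball z₀ R) :=
    DifferentiableOn.diffContOnCl (by rwa [closure_ball _ hR.ne'])
  have hfac : (0 : ℝ) < n.factorial := by exact_mod_cast n.factorial_pos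
  have hcauchy : ‖(R : ℂ) ^ n * (n.factorial : ℂ)⁻¹ * iteratedDeriv n h z₀‖ ≤ N := by
    have := Complex.norm_iteratedDeriv_le_of_forall_mem_sphere_norm_le n hR hdc
      fun z hz => hN z (sphere_subset_closedBall hz)
    rw [norm_mul, norm_mul, norm_pow, norm_inv, Complex.norm_natCast, Complex.norm_of_nonneg hR.le]
    calc R ^ n * (n.factorial : ℝ)⁻¹ * ‖iteratedDeriv n h z₀‖
        ≤ R ^ n * (n.factorial : ℝ)⁻¹ * (n.factorial * N / R ^ n) := by gcongr
      _ = N := by field_simp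
  have hterm : (n.factorial : ℂ)⁻¹ • (z - z₀) ^ n • iteratedDeriv n h z₀ =
      ((z - z₀) / R) ^ n * ((R : ℂ) ^ n * (n.factorial : ℂ)⁻¹ * iteratedDeriv n h z₀) := by
    rw [smul_eq_mul, smul_eq_mul, div_pow]
    field_simp
  have hq : ‖(z - z₀) / R‖ ≤ σ * (1 / 2) := by
    rw [norm_div, Complex.norm_of_nonneg hR.le, ← dist_eq_norm, div_le_iff₀ hR]
    linarith
  rw [hterm, norm_mul, norm_pow]
  have hpow : ‖(z - z₀) / R‖ ^ n ≤ σ ^ n * (1 / 2) ^ n := by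
    rw [← mul_pow]; gcongr
  have hhalf : (0 : ℝ) ≤ (1 / 2) ^ n := by positivity
  -- Low-order terms use the smallness of the coefficient, high-order terms use Cauchy's bound and
  -- `σ ^ n ≤ σ ^ L`. The spare factor `(1 / 2) ^ n` makes both sums converge.
  rcases lt_or_ge n L with hn | hn
  · calc _ ≤ σ ^ n * (1 / 2) ^ n * η := by gcongr; exact hη n hn
      _ ≤ 1 * (1 / 2) ^ n * η := by gcongr; exact pow_le_one₀ hσ0 hσ1
      _ ≤ (η + N * σ ^ L) * (1 / 2) ^ n := by
        have : 0 ≤ N * σ ^ L * (1 / 2) ^ n := by positivity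
        linarith
  · calc _ ≤ σ ^ n * (1 / 2) ^ n * N := by gcongr
      _ ≤ σ ^ L * (1 / 2) ^ n * N := by
        gcongr ?_ * _ * _
        exact pow_le_pow_of_le_one hσ0 hσ1 hn
      _ ≤ (η + N * σ ^ L) * (1 / 2) ^ n := by
        have : 0 ≤ η * (1 / 2) ^ n := by positivity
        linarith

/-- Clearing denominators in the value of an integer polynomial at a rational point. -/
theorem exists_int_eq_den_pow_mul_sum {e : ℕ} (c : Fin e × Fin e → ℤ) (x y : ℚ) :
    ∃ W : ℤ, (W : ℚ) =
      x.den ^ e * y.den ^ e * ∑ i, (c i : ℚ) * (x ^ (i.1 : ℕ) * y ^ (i.2 : ℕ)) := by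
  have key : ∀ (x : ℚ) (i : Fin e),
      (x.den : ℚ) ^ e * x ^ (i : ℕ) = x.num ^ (i : ℕ) * x.den ^ (e - i) := by
    intro x i
    have h1 : (x.den : ℚ) ^ e = x.den ^ (i : ℕ) * x.den ^ (e - i) := by
      rw [← pow_add, Nat.add_sub_cancel' i.2.le]
    rw [h1]
    conv_rhs => rw [← Rat.mul_den_eq_num x, mul_pow]
    ring
  refine ⟨∑ i, c i * ((x.num ^ (i.1 : ℕ) * x.den ^ (e - i.1)) *
    (y.num ^ (i.2 : ℕ) * y.den ^ (e - i.2))), ?_⟩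
  push_cast
  rw [Finset.mul_sum]
  refine Finset.sum_congr rfl fun i _ => ?_
  rw [← key x i.1, ← key y i.2]
  ring

theorem Rat.den_le_and_norm_le_of_mulHeight₁_le {x : ℚ} {H : ℝ} (h : Height.mulHeight₁ x ≤ H) :
    (x.den : ℝ) ≤ H ∧ ‖(x : ℂ)‖ ≤ H := by
  rw [Rat.mulHeight₁_eq_max, Nat.cast_max, max_le_iff] at h
  refine ⟨h.2, ?_⟩
  have h1 : ‖(x : ℂ)‖ = |(x : ℝ)| := by
    rw [← Complex.ofReal_ratCast, Complex.norm_real, Real.norm_eq_abs]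
  have hden : (1 : ℝ) ≤ x.den := by exact_mod_cast x.den_pos
  rw [h1, Rat.cast_def, abs_div, Nat.abs_cast]
  refine (div_le_self (abs_nonneg _) hden).trans (le_trans (le_of_eq ?_) h.1)
  rw [← Int.cast_abs, Int.abs_eq_natAbs, Int.cast_natCast]

/-- Liouville's inequality for values of integer polynomials at rational points. -/
theorem sum_eq_zero_of_norm_lt {e : ℕ} (c : Fin e × Fin e → ℤ) {x y : ℚ} {H : ℝ}
    (hx : Height.mulHeight₁ x ≤ H) (hy : Height.mulHeight₁ y ≤ H)
    (hlt : ‖∑ i, (c i : ℂ) * ((x : ℂ) ^ (i.1 : ℕ) * (y : ℂ) ^ (i.2 : ℕ))‖ * H ^ (2 * e) < 1) :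
    ∑ i, (c i : ℂ) * ((x : ℂ) ^ (i.1 : ℕ) * (y : ℂ) ^ (i.2 : ℕ)) = 0 := by
  obtain ⟨W, hW⟩ := exists_int_eq_den_pow_mul_sum c x y
  have hWC : (W : ℂ) = x.den ^ e * y.den ^ e *
      ∑ i, (c i : ℂ) * ((x : ℂ) ^ (i.1 : ℕ) * (y : ℂ) ^ (i.2 : ℕ)) := by
    exact_mod_cast congrArg (fun t : ℚ => (t : ℂ)) hW
  have hxd := (Rat.den_le_and_norm_le_of_mulHeight₁_le hx).1
  have hyd := (Rat.den_le_and_norm_le_of_mulHeight₁_le hy).1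
  have hnorm : ‖(W : ℂ)‖ < 1 := by
    rw [hWC, norm_mul, norm_mul, norm_pow, norm_pow, Complex.norm_natCast, Complex.norm_natCast]
    refine lt_of_le_of_lt ?_ hlt
    rw [mul_comm, two_mul, pow_add]
    have : (0 : ℝ) ≤ H := le_trans (by positivity) hxd
    gcongr
  have hW0 : W = 0 := by
    rw [Complex.norm_intCast] at hnorm
    have : |W| < 1 := by exact_mod_cast hnorm
    exact Int.abs_lt_one_iff.1 this
  rw [hW0, Int.cast_zero] at hWC
  have h1 : (x.den : ℂ) ≠ 0 := by exact_mod_cast x.den_nz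
  have h2 : (y.den : ℂ) ≠ 0 := by exact_mod_cast y.den_nz
  exact (mul_eq_zero.1 hWC.symm).resolve_left (mul_ne_zero (pow_ne_zero _ h1) (pow_ne_zero _ h2))

/-- The zeros of a nonzero polynomial lie on a curve of any prescribed larger degree. -/
theorem exists_isPlaneCurveOfDegree {e d : ℕ} (hd : 1 ≤ d) (hed : 2 * e ≤ d)
    (c : Fin e × Fin e → ℤ) (hc : c ≠ 0) :
    ∃ Γ, IsPlaneCurveOfDegree d Γ ∧
      ∀ x y : ℂ, ∑ i, (c i : ℂ) * (x ^ (i.1 : ℕ) * y ^ (i.2 : ℕ)) = 0 → (x, y) ∈ Γ := by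
  let m : Fin e × Fin e → Fin 2 →₀ ℕ := fun i =>
    Finsupp.equivFunOnFinite.symm ![(i.1 : ℕ), (i.2 : ℕ)]
  let P : MvPolynomial (Fin 2) ℂ := ∑ i, MvPolynomial.monomial (m i) (c i : ℂ)
  have hinj : Function.Injective m := by
    intro i j hij
    have h := Finsupp.equivFunOnFinite.symm.injective hij
    have h0 := congrFun h 0
    have h1 := congrFun h 1
    simp only [Matrix.cons_val_zero, Matrix.cons_val_one] at h0 h1
    exact Prod.ext (Fin.ext h0) (Fin.ext h1)
  have hP0 : P ≠ 0 := by
    obtain ⟨j, hj⟩ := Function.ne_iff.1 hc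
    intro h
    have h1 : P.coeff (m j) = c j := by
      simp only [P, MvPolynomial.coeff_sum, MvPolynomial.coeff_monomial, hinj.eq_iff]
      simp
    rw [h, MvPolynomial.coeff_zero] at h1
    exact hj (by exact_mod_cast h1.symm)
  have hdeg : P.totalDegree ≤ d := by
    refine MvPolynomial.totalDegree_finsetSum_le fun i _ => ?_
    refine (MvPolynomial.totalDegree_monomial_le _ _).trans ?_
    rw [Finsupp.sum_fintype _ _ (fun _ => rfl), Fin.sum_univ_two]
    have h1 := i.1.2
    have h2 := i.2.2
    simp only [m, Finsupp.equivFunOnFinite_symm_apply_apply, Matrix.cons_val_zero,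
      Matrix.cons_val_one, id]
    omega
  have heval : ∀ x y : ℂ, MvPolynomial.eval ![x, y] P =
      ∑ i, (c i : ℂ) * (x ^ (i.1 : ℕ) * y ^ (i.2 : ℕ)) := by
    intro x y
    simp only [P, map_sum, MvPolynomial.eval_monomial]
    refine Finset.sum_congr rfl fun i _ => ?_
    rw [Finsupp.prod_fintype _ _ (fun _ => pow_zero _), Fin.prod_univ_two]
    simp [m]
  -- A power of `X` pads the degree to exactly `d`; it only enlarges the zero set.
  refine ⟨_, ⟨hd, P * MvPolynomial.X 0 ^ (d - P.totalDegree), ?_, rfl⟩, ?_⟩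
  · rw [MvPolynomial.totalDegree_mul_of_isDomain hP0 (pow_ne_zero _ (MvPolynomial.X_ne_zero 0)),
      MvPolynomial.totalDegree_X_pow]
    omega
  · intro x y hxy
    change MvPolynomial.eval ![x, y] _ = 0
    rw [map_mul, heval, hxy, zero_mul]

/-- Siegel's lemma is applied to the first `L` Taylor coefficients of the `e * e = 4 * L` monomials
in `f₁`, `f₂`. The resulting polynomial depends only on the disc, so one curve serves all rational
points near the centre. -/
theorem exists_curve_of_norm_le {e d L T : ℕ} {f₁ f₂ : ℂ → ℂ} {z₀ : ℂ} {R M H η σ : ℝ}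
    (hL : 0 < L) (hT : 0 < T) (he : e * e = 4 * L) (hd : 1 ≤ d) (hed : 2 * e ≤ d) (hR : 0 < R)
    (hf₁ : DifferentiableOn ℂ f₁ (closedBall z₀ R)) (hf₂ : DifferentiableOn ℂ f₂ (closedBall z₀ R))
    (hM : 1 ≤ M) (hM₁ : ∀ z ∈ closedBall z₀ R, ‖f₁ z‖ ≤ M) (hM₂ : ∀ z ∈ closedBall z₀ R, ‖f₂ z‖ ≤ M)
    (hH : 0 < H) (hσ0 : 0 ≤ σ) (hσ1 : σ ≤ 1) (hη : 0 ≤ η) (hTη : 4 * (4 * L) * M ^ (2 * e) ≤ η * T)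
    (hsmall : (2 * η + 2 * (4 * L * (T * M ^ (2 * e))) * σ ^ L) * H ^ (2 * e) < 1) :
    ∃ Γ, IsPlaneCurveOfDegree d Γ ∧ ∀ z, dist z z₀ ≤ σ * R / 2 →
      (f₁ z, f₂ z) ∈ rationalPointsOfHeightLE H → (f₁ z, f₂ z) ∈ Γ := by
  let g : Fin e × Fin e → ℂ → ℂ := fun i z => f₁ z ^ (i.1 : ℕ) * f₂ z ^ (i.2 : ℕ)
  have hgd : ∀ i, DifferentiableOn ℂ (g i) (closedBall z₀ R) := fun i =>
    (hf₁.pow _).mul (hf₂.pow _)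
  have hgM : ∀ i, ∀ z ∈ closedBall z₀ R, ‖g i z‖ ≤ M ^ (2 * e) := by
    intro i z hz
    simp only [g]
    rw [norm_mul, norm_pow, norm_pow, two_mul, pow_add]
    have h1 : ‖f₁ z‖ ^ (i.1 : ℕ) ≤ M ^ e :=
      (pow_le_pow_left₀ (norm_nonneg _) (hM₁ z hz) _).trans (pow_le_pow_right₀ hM i.1.2.le)
    have h2 : ‖f₂ z‖ ^ (i.2 : ℕ) ≤ M ^ e :=
      (pow_le_pow_left₀ (norm_nonneg _) (hM₂ z hz) _).trans (pow_le_pow_right₀ hM i.2.2.le)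
    gcongr
  have hcard : Fintype.card (Fin e × Fin e) = 4 * L := by simp [he]
  let v : Fin e × Fin e → Fin L → ℂ := fun i n =>
    (R : ℂ) ^ (n : ℕ) * (((n : ℕ).factorial : ℕ) : ℂ)⁻¹ * iteratedDeriv n (g i) z₀
  have hv : ∀ i n, ‖v i n‖ ≤ M ^ (2 * e) := by
    intro i n
    have hdc : DiffContOnCl ℂ (g i) (ball z₀ R) :=
      DifferentiableOn.diffContOnCl (by rw [closure_ball _ hR.ne']; exact hgd i)
    have := Complex.norm_iteratedDeriv_le_of_forall_mem_sphere_norm_le n hR hdc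
      fun z hz => hgM i z (sphere_subset_closedBall hz)
    have hfac : (0 : ℝ) < (n : ℕ).factorial := by exact_mod_cast (n : ℕ).factorial_pos
    simp only [v]
    rw [norm_mul, norm_mul, norm_pow, norm_inv, Complex.norm_natCast, Complex.norm_of_nonneg hR.le]
    calc R ^ (n : ℕ) * ((n : ℕ).factorial : ℝ)⁻¹ * ‖iteratedDeriv n (g i) z₀‖
        ≤ R ^ (n : ℕ) * ((n : ℕ).factorial : ℝ)⁻¹ *
          ((n : ℕ).factorial * M ^ (2 * e) / R ^ (n : ℕ)) := by gcongr
      _ = M ^ (2 * e) := by field_simp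
  obtain ⟨c, hc0, hcT, hc⟩ := exists_int_combination_norm_le hL hT hcard (by positivity) v hv hTη
  obtain ⟨Γ, hΓ, hmem⟩ := exists_isPlaneCurveOfDegree hd hed c hc0
  refine ⟨Γ, hΓ, fun z hz hrat => hmem _ _ ?_⟩
  obtain ⟨x, y, hxy, hht⟩ := hrat
  obtain ⟨hx, hy⟩ := Prod.ext_iff.1 hxy
  simp only at hx hy
  rw [max_le_iff] at hht
  have hsumd : DifferentiableOn ℂ (fun z => ∑ i, (c i : ℂ) * g i z) (closedBall z₀ R) :=
    DifferentiableOn.fun_sum fun i _ => (hgd i).const_mul _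
  have hsumN : ∀ z ∈ closedBall z₀ R, ‖∑ i, (c i : ℂ) * g i z‖ ≤ 4 * L * (T * M ^ (2 * e)) := by
    intro z hz
    calc _ ≤ ∑ i : Fin e × Fin e, (T : ℝ) * M ^ (2 * e) := by
          refine norm_sum_le_of_le _ fun i _ => ?_
          rw [norm_mul, Complex.norm_intCast]
          have : (|c i| : ℝ) ≤ T := by exact_mod_cast hcT i
          exact mul_le_mul this (hgM i z hz) (norm_nonneg _) (Nat.cast_nonneg T)
      _ = 4 * L * (T * M ^ (2 * e)) := by
          rw [Finset.sum_const, Finset.card_univ, hcard, nsmul_eq_mul]; push_cast; ring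
  have hcoef : ∀ n < L, ‖(R : ℂ) ^ n * (n.factorial : ℂ)⁻¹ *
      iteratedDeriv n (fun z => ∑ i, (c i : ℂ) * g i z) z₀‖ ≤ η := by
    intro n hn
    have hcd : ∀ i, ContDiffAt ℂ n (g i) z₀ := fun i =>
      ((hgd i).analyticAt (closedBall_mem_nhds z₀ hR)).contDiffAt
    have h1 : iteratedDeriv n (fun z => ∑ i, (c i : ℂ) * g i z) z₀ =
        ∑ i, (c i : ℂ) * iteratedDeriv n (g i) z₀ := by
      rw [iteratedDeriv_fun_sum fun i _ => contDiffAt_const.mul (hcd i)]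
      exact Finset.sum_congr rfl fun i _ => iteratedDeriv_const_mul_field _ _
    rw [h1, Finset.mul_sum]
    refine le_trans (le_of_eq ?_) (hc ⟨n, hn⟩)
    congr 1
    refine Finset.sum_congr rfl fun i _ => ?_
    simp only [v]
    ring
  have hfin := norm_le_of_taylorCoeff_le hR hsumd hsumN hcoef hη hσ0 hσ1 hz
  simp only [g, hx, hy] at hfin
  rw [hx, hy]
  refine sum_eq_zero_of_norm_lt c hht.1 hht.2 (lt_of_le_of_lt ?_ hsmall)
  gcongr

/-! ### Choice of parameters and the count on a disc with bounded functions -/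

/-- The constant governing the size of the discs on which rational points lie on a single curve. -/
def localConst (n A : ℕ) : ℕ := 8 * (256 * (32 * n) ^ 2 * A ^ (128 * n)) ^ 2

theorem exists_curve_of_dist_le {n A : ℕ} (hn : 1 ≤ n) (hA : 1 ≤ A) {h : ℝ} (hh : 1 ≤ h)
    {f₁ f₂ : ℂ → ℂ} {z₀ : ℂ} {R : ℝ} (hR : 0 < R)
    (hf₁ : DifferentiableOn ℂ f₁ (closedBall z₀ R)) (hf₂ : DifferentiableOn ℂ f₂ (closedBall z₀ R))
    (hM₁ : ∀ z ∈ closedBall z₀ R, ‖f₁ z‖ ≤ A * h ^ (2 * n))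
    (hM₂ : ∀ z ∈ closedBall z₀ R, ‖f₂ z‖ ≤ A * h ^ (2 * n)) :
    ∃ Γ, IsPlaneCurveOfDegree (128 * n + 1) Γ ∧ ∀ z, dist z z₀ ≤ R / (2 * (localConst n A * h)) →
      (f₁ z, f₂ z) ∈ rationalPointsOfHeightLE (h ^ (2 * n)) → (f₁ z, f₂ z) ∈ Γ := by
  have hA' : (1 : ℝ) ≤ A := by exact_mod_cast hA
  have hn' : (1 : ℝ) ≤ n := by exact_mod_cast hn
  obtain ⟨e, he⟩ : ∃ e, e = 64 * n := ⟨_, rfl⟩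
  obtain ⟨L, hL⟩ : ∃ L, L = (32 * n) ^ 2 := ⟨_, rfl⟩
  obtain ⟨H, hH⟩ : ∃ H : ℝ, H = h ^ (2 * n) := ⟨_, rfl⟩
  have hH1 : 1 ≤ H := hH ▸ one_le_pow₀ hh
  have hL0 : 0 < L := by rw [hL]; positivity
  have hL1 : (1 : ℝ) ≤ L := by exact_mod_cast hL0
  have hhL : h ^ L = H ^ (8 * e) := by rw [hH, ← pow_mul, hL, he]; congr 1; ring
  obtain ⟨B, hB⟩ : ∃ B : ℝ, B = (A : ℝ) ^ (2 * e) := ⟨_, rfl⟩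
  have hB1 : 1 ≤ B := hB ▸ one_le_pow₀ hA'
  obtain ⟨P, hP⟩ : ∃ P : ℝ, P = H ^ (2 * e) := ⟨_, rfl⟩
  have hP1 : 1 ≤ P := hP ▸ one_le_pow₀ hH1
  -- `L` is quadratic in `n` while `e` is linear. The gain `h ^ L = P ^ 4` therefore beats the loss,
  -- which is `P ^ 3` from the size of the combination and `P` from the denominators.
  have hhLP : h ^ L = P ^ 4 := by rw [hhL, hP, ← pow_mul]; congr 1; ring
  have hMP : (A * H) ^ (2 * e) = B * P := by rw [mul_pow, hB, hP]
  have hQ : (localConst n A : ℝ) = 8 * (256 * L * B) ^ 2 := by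
    rw [localConst, hB, hL, he]
    push_cast
    ring_nf
  obtain ⟨Q, hQdef⟩ : ∃ Q : ℝ, Q = 8 * (256 * L * B) ^ 2 := ⟨_, rfl⟩
  rw [hQ, ← hQdef]
  have hLB : 1 ≤ 256 * L * B := by nlinarith
  have hQ1 : 1 ≤ Q := by rw [hQdef]; nlinarith
  obtain ⟨T, hT1, hT2⟩ : ∃ T : ℕ, 128 * L * B * P ^ 2 ≤ T ∧ (T : ℝ) ≤ 256 * L * B * P ^ 2 := by
    refine ⟨⌈128 * L * B * P ^ 2⌉₊, Nat.le_ceil _, ?_⟩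
    have h1 := Nat.ceil_lt_add_one (by positivity : (0 : ℝ) ≤ 128 * L * B * P ^ 2)
    have h2 : (1 : ℝ) ≤ L * B * P ^ 2 :=
      one_le_mul_of_one_le_of_one_le (one_le_mul_of_one_le_of_one_le hL1 hB1) (one_le_pow₀ hP1)
    linarith
  have hT0 : 0 < T := by
    have : (0 : ℝ) < T := lt_of_lt_of_le (by positivity) hT1
    exact_mod_cast this
  have hQh : 1 ≤ Q * h := one_le_mul_of_one_le_of_one_le hQ1 hh
  rw [← hH] at hM₁ hM₂ ⊢
  obtain ⟨Γ, hΓ, hmem⟩ := exists_curve_of_norm_le (e := e) (d := 128 * n + 1) (L := L) (T := T)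
    (f₁ := f₁) (f₂ := f₂) (z₀ := z₀) (R := R) (M := A * H) (H := H) (η := 1 / (8 * P))
    (σ := 1 / (Q * h)) hL0 hT0 (by rw [he, hL]; ring) (by omega) (by omega) hR hf₁ hf₂
    (one_le_mul_of_one_le_of_one_le hA' hH1) hM₁ hM₂ (by positivity) (by positivity)
    (by rw [div_le_one (by positivity)]; exact hQh) (by positivity)
    (by
      rw [hMP, one_div_mul_eq_div, le_div_iff₀ (by positivity)]
      refine le_trans (le_of_eq ?_) hT1
      ring)
    (by
      have hσ : (1 / (Q * h)) ^ L ≤ 1 / (Q * P ^ 4) := by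
        rw [one_div_pow, mul_pow, hhLP]
        gcongr
        exact le_self_pow₀ hQ1 hL0.ne'
      have hN : 4 * L * (T * (B * P)) ≤ (256 * L * B) ^ 2 * P ^ 3 :=
        calc 4 * L * (T * (B * P)) ≤ 4 * L * ((256 * L * B * P ^ 2) * (B * P)) := by gcongr
          _ = (256 * L * B) * P ^ 3 * (4 * L * B) := by ring
          _ ≤ (256 * L * B) * P ^ 3 * (256 * L * B) := by gcongr; norm_num
          _ = _ := by ring
      rw [hMP, ← hP]
      -- The low-order and high-order terms contribute `1 / 4` each; this is what fixes `η` and `Q`.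
      calc _ ≤ (2 * (1 / (8 * P)) + 2 * ((256 * L * B) ^ 2 * P ^ 3) * (1 / (Q * P ^ 4))) * P := by
            gcongr
        _ = 1 / 2 := by
            rw [hQdef]
            have : (256 * L * B : ℝ) ≠ 0 := by positivity
            field_simp
            norm_num
        _ < 1 := by norm_num)
  refine ⟨Γ, hΓ, fun z hz hr => hmem z (hz.trans (le_of_eq ?_)) hr⟩
  field_simp

/-- The constant in the count of curves on a disc where both functions are suitably bounded. -/
def discConst (n A : ℕ) : ℕ := 324 * localConst n A ^ 2

theorem exists_curves_of_norm_le {n A : ℕ} (hn : 1 ≤ n) (hA : 1 ≤ A) {h : ℝ} (hh : 1 ≤ h)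
    {f₁ f₂ : ℂ → ℂ} {a : ℂ} {r : ℝ} (hr : 0 < r)
    (hf₁ : DifferentiableOn ℂ f₁ (ball a r)) (hf₂ : DifferentiableOn ℂ f₂ (ball a r))
    (hM₁ : ∀ z ∈ ball a r, ‖f₁ z‖ ≤ A * h ^ (2 * n))
    (hM₂ : ∀ z ∈ ball a r, ‖f₂ z‖ ≤ A * h ^ (2 * n)) :
    ∃ 𝒞 : Finset (Set (ℂ × ℂ)), (𝒞.card : ℝ) ≤ discConst n A * h ^ 2 ∧
      (∀ Γ ∈ 𝒞, IsPlaneCurveOfDegree (128 * n + 1) Γ) ∧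
      ∀ z ∈ closedBall a (r / 2), (f₁ z, f₂ z) ∈ rationalPointsOfHeightLE (h ^ (2 * n)) →
        ∃ Γ ∈ 𝒞, (f₁ z, f₂ z) ∈ Γ := by
  classical
  obtain ⟨Q, hQ⟩ : ∃ Q : ℝ, Q = localConst n A := ⟨_, rfl⟩
  have hQ1 : 1 ≤ Q := by
    have : 1 ≤ localConst n A := by unfold localConst; exact Nat.succ_le_of_lt (by positivity)
    rw [hQ]; exact_mod_cast this
  have hQh : 1 ≤ Q * h := one_le_mul_of_one_le_of_one_le hQ1 hh
  -- The factor 16 brings the cell diameter `2 * r / m` down to the admissible `(r / 4) / (2 * Q *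
  -- h)`.
  obtain ⟨m, hm⟩ : ∃ m, m = ⌈16 * (Q * h)⌉₊ := ⟨_, rfl⟩
  have hm1 : 16 * (Q * h) ≤ m := hm ▸ Nat.le_ceil _
  have hm2 : (m : ℝ) + 1 ≤ 18 * (Q * h) := by
    have := Nat.ceil_lt_add_one (by positivity : (0 : ℝ) ≤ 16 * (Q * h))
    rw [← hm] at this
    linarith
  have hm0 : 0 < m := by
    have : (0 : ℝ) < m := lt_of_lt_of_le (by positivity) hm1
    exact_mod_cast this
  obtain ⟨ι, _, q, hcard, hq⟩ := exists_cells a (half_pos hr) hm0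
  have hcurve : ∀ i : ι, ∃ Γ, IsPlaneCurveOfDegree (128 * n + 1) Γ ∧
      ∀ z ∈ closedBall a (r / 2), q z = i →
        (f₁ z, f₂ z) ∈ rationalPointsOfHeightLE (h ^ (2 * n)) → (f₁ z, f₂ z) ∈ Γ := by
    intro i
    obtain ⟨z₀, hz₀⟩ : ∃ z₀ ∈ closedBall a (r / 2), ∀ z ∈ closedBall a (r / 2), q z = i →
        dist z z₀ ≤ 4 * (r / 2) / m := by
      by_cases hi : ∃ z₀ ∈ closedBall a (r / 2), q z₀ = i
      · obtain ⟨z₀, hz₀, rfl⟩ := hi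
        exact ⟨z₀, hz₀, fun z hz h => hq z hz z₀ hz₀ h⟩
      · exact ⟨a, mem_closedBall_self (by positivity), fun z hz h => absurd ⟨z, hz, h⟩ hi⟩
    have hsub : closedBall z₀ (r / 4) ⊆ ball a r := by
      refine closedBall_subset_ball' ?_
      have := mem_closedBall.1 hz₀.1
      linarith
    obtain ⟨Γ, hΓ, hmem⟩ := exists_curve_of_dist_le hn hA hh (z₀ := z₀) (R := r / 4) (by positivity)
      (hf₁.mono hsub) (hf₂.mono hsub) (fun z hz => hM₁ z (hsub hz)) (fun z hz => hM₂ z (hsub hz))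
    refine ⟨Γ, hΓ, fun z hz hzi => hmem z ((hz₀.2 z hz hzi).trans ?_)⟩
    rw [← hQ]
    calc 4 * (r / 2) / m ≤ 4 * (r / 2) / (16 * (Q * h)) := by gcongr
      _ = r / 4 / (2 * (Q * h)) := by field_simp; norm_num
  choose Γ hΓ hmem using hcurve
  refine ⟨Finset.univ.image Γ, ?_, ?_, fun z hz hrat =>
    ⟨Γ (q z), Finset.mem_image_of_mem _ (Finset.mem_univ _), hmem _ z hz rfl hrat⟩⟩
  · calc ((Finset.univ.image Γ).card : ℝ) ≤ (Fintype.card ι : ℝ) := by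
          exact_mod_cast Finset.card_image_le
      _ = ((m : ℝ) + 1) ^ 2 := by rw [hcard]; push_cast; ring
      _ ≤ (18 * (Q * h)) ^ 2 := by gcongr
      _ = discConst n A * h ^ 2 := by rw [discConst, hQ]; push_cast; ring
  · intro Γ' h'
    obtain ⟨i, -, rfl⟩ := Finset.mem_image.1 h'
    exact hΓ i

/-! ### Computability of the constants and assembly -/

theorem Primrec.nat_pow : Primrec₂ ((· ^ ·) : ℕ → ℕ → ℕ) := Primrec₂.unpaired'.1 Nat.Primrec.pow

theorem primrec_growthConst : Primrec growthConst := by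
  have hk : Primrec harnackConst := by
    unfold harnackConst
    exact Primrec.nat_pow.comp (Primrec.const _)
      (Primrec.nat_mul.comp (Primrec.const _) Primrec.succ)
  have hd : Primrec doublingConst := by
    unfold doublingConst
    exact Primrec.nat_pow.comp hk (Primrec.nat_mul.comp (Primrec.const _)
      (Primrec.succ.comp (Primrec.nat_mul.comp (Primrec.const _) Primrec.id)))
  unfold growthConst
  exact Primrec.nat_mul.comp hd hk

theorem primrec_discConst : Primrec₂ discConst := by
  unfold discConst localConst
  have hsq : Primrec fun a : ℕ => a ^ 2 := Primrec.nat_pow.comp Primrec.id (Primrec.const 2)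
  have hmul : ∀ k : ℕ, Primrec fun x : ℕ × ℕ => k * x.1 := fun k =>
    Primrec.nat_mul.comp (Primrec.const k) Primrec.fst
  exact Primrec.nat_mul.comp (Primrec.const _) (hsq.comp (Primrec.nat_mul.comp (Primrec.const _)
    (hsq.comp (Primrec.nat_mul.comp
      (Primrec.nat_mul.comp (Primrec.const _) (hsq.comp (hmul 32)))
      (Primrec.nat_pow.comp Primrec.snd (hmul 128))))))

theorem norm_le_of_mem_rationalPointsOfHeightLE {w : ℂ × ℂ} {H : ℝ}
    (hw : w ∈ rationalPointsOfHeightLE H) : ‖w.1‖ ≤ H ∧ ‖w.2‖ ≤ H := by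
  obtain ⟨x, y, rfl, h⟩ := hw
  rw [max_le_iff] at h
  exact ⟨(Rat.den_le_and_norm_le_of_mulHeight₁_le h.1).2,
    (Rat.den_le_and_norm_le_of_mulHeight₁_le h.2).2⟩

theorem mainTheorem4 :
    ∃ (C : ℕ → ℕ) (c : ℕ → ℕ → ℕ), Computable C ∧ Computable₂ c ∧
      ∀ (p : ℕ) (ε : ℝ), 0 < ε →
      ∀ (a : ℂ) (r : ℝ), 0 < r →
      ∀ f₁ f₂ : ℂ → ℂ,
        DifferentiableOn ℂ f₁ (Metric.ball a r) → DifferentiableOn ℂ f₂ (Metric.ball a r) →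
        IsPValentOn p f₁ (Metric.ball a r) → IsPValentOn p f₂ (Metric.ball a r) →
      ∀ H : ℝ, 1 ≤ H →
        ∃ 𝒞 : Finset (Set (ℂ × ℂ)),
          (𝒞.card : ℝ) ≤ c p ⌈1 / ε⌉₊ * H ^ ε ∧
          (∀ Γ ∈ 𝒞, IsPlaneCurveOfDegree (C ⌈1 / ε⌉₊) Γ) ∧
          ∀ z ∈ Metric.closedBall a (r / 2), (f₁ z, f₂ z) ∈ rationalPointsOfHeightLE H →
            ∃ Γ ∈ 𝒞, (f₁ z, f₂ z) ∈ Γ := by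
  classical
  refine ⟨fun n => 128 * n + 1, fun p n => (129 ^ 2 + p) ^ 2 * discConst n (growthConst p),
    (Primrec.succ.comp (Primrec.nat_mul.comp (Primrec.const 128) Primrec.id)).to_comp,
    Primrec.to_comp (Primrec.nat_mul.comp
      (Primrec.nat_pow.comp (Primrec.nat_add.comp (Primrec.const _) Primrec.fst) (Primrec.const 2))
      (primrec_discConst.comp Primrec.snd (primrec_growthConst.comp Primrec.fst))), ?_⟩
  intro p ε hε a r hr f₁ f₂ hf₁ hf₂ hp₁ hp₂ H hH
  obtain ⟨n, hndef⟩ : ∃ n, n = ⌈1 / ε⌉₊ := ⟨_, rfl⟩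
  have hn : 1 ≤ n := hndef ▸ Nat.ceil_pos.2 (by positivity)
  have hn' : (0 : ℝ) < n := by exact_mod_cast hn
  have hnε : (n : ℝ)⁻¹ ≤ ε := inv_le_of_inv_le₀ hε (by rw [← one_div, hndef]; exact Nat.le_ceil _)
  rw [← hndef]
  have hH0 : 0 < H := by linarith
  -- Here `h = H ^ (1 / (2 * n))`: cells number about `h ^ 2`, since the domain has real dimension
  -- two, and `h ^ 2 = H ^ (1 / n) ≤ H ^ ε`.
  obtain ⟨h, hh1, hhH, hhε⟩ : ∃ h : ℝ, 1 ≤ h ∧ h ^ (2 * n) = H ∧ h ^ 2 ≤ H ^ ε := by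
    refine ⟨H ^ (((2 * n : ℕ) : ℝ)⁻¹), Real.one_le_rpow hH (by positivity),
      Real.rpow_inv_natCast_pow hH0.le (by omega), ?_⟩
    rw [← Real.rpow_mul_natCast hH0.le]
    refine Real.rpow_le_rpow_of_exponent_le hH (le_trans (le_of_eq ?_) hnε)
    push_cast
    field_simp
  have hA := one_le_growthConst p
  obtain ⟨F, hFcard, hF, hFcov⟩ := hp₁.exists_cover hr hH0 hf₁
  have hcurves : ∀ b : ℂ × ℝ, ∃ 𝒞 : Finset (Set (ℂ × ℂ)), b ∈ F →
      (𝒞.card : ℝ) ≤ (129 ^ 2 + p) * (discConst n (growthConst p) * h ^ 2) ∧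
      (∀ Γ ∈ 𝒞, IsPlaneCurveOfDegree (128 * n + 1) Γ) ∧
      ∀ z ∈ closedBall b.1 (b.2 / 2), (f₁ z, f₂ z) ∈ rationalPointsOfHeightLE H →
        ∃ Γ ∈ 𝒞, (f₁ z, f₂ z) ∈ Γ := by
    intro b
    by_cases hb : b ∈ F
    swap
    · exact ⟨∅, fun h => absurd h hb⟩
    obtain ⟨hb0, hbsub, hbM⟩ := hF b hb
    -- The discs for `f₂` lie inside the disc `b` where `f₁` is already controlled, so both bounds
    -- hold on them.
    obtain ⟨F', hFcard', hF', hFcov'⟩ := (hp₂.mono hbsub).exists_cover hb0 hH0 (hf₂.mono hbsub)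
    have hinner : ∀ b' : ℂ × ℝ, ∃ 𝒞 : Finset (Set (ℂ × ℂ)), b' ∈ F' →
        (𝒞.card : ℝ) ≤ discConst n (growthConst p) * h ^ 2 ∧
        (∀ Γ ∈ 𝒞, IsPlaneCurveOfDegree (128 * n + 1) Γ) ∧
        ∀ z ∈ closedBall b'.1 (b'.2 / 2), (f₁ z, f₂ z) ∈ rationalPointsOfHeightLE H →
          ∃ Γ ∈ 𝒞, (f₁ z, f₂ z) ∈ Γ := by
      intro b'
      by_cases hb' : b' ∈ F'
      swap
      · exact ⟨∅, fun h => absurd h hb'⟩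
      obtain ⟨hb0', hbsub', hbM'⟩ := hF' b' hb'
      obtain ⟨𝒞, h𝒞⟩ := exists_curves_of_norm_le hn hA hh1 hb0'
        (hf₁.mono (hbsub'.trans hbsub)) (hf₂.mono (hbsub'.trans hbsub))
        (fun z hz => by rw [hhH]; exact hbM z (hbsub' hz))
        (fun z hz => by rw [hhH]; exact hbM' z hz)
      rw [hhH] at h𝒞
      exact ⟨𝒞, fun _ => h𝒞⟩
    choose 𝒞 h𝒞 using hinner
    refine ⟨F'.biUnion 𝒞, fun _ => ⟨?_, ?_, ?_⟩⟩
    · calc ((F'.biUnion 𝒞).card : ℝ) ≤ ∑ b' ∈ F', ((𝒞 b').card : ℝ) := by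
            exact_mod_cast Finset.card_biUnion_le
        _ ≤ F'.card * (discConst n (growthConst p) * h ^ 2) := by
            rw [← nsmul_eq_mul]
            exact Finset.sum_le_card_nsmul _ _ _ fun b' hb' => (h𝒞 b' hb').1
        _ ≤ _ := by gcongr; exact_mod_cast hFcard'
    · intro Γ hΓ
      obtain ⟨b', hb', hΓ'⟩ := Finset.mem_biUnion.1 hΓ
      exact (h𝒞 b' hb').2.1 Γ hΓ'
    · intro z hz hrat
      obtain ⟨b', hb', hzb'⟩ := hFcov' z hz (norm_le_of_mem_rationalPointsOfHeightLE hrat).2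
      obtain ⟨Γ, hΓ, hmem⟩ := (h𝒞 b' hb').2.2 z hzb' hrat
      exact ⟨Γ, Finset.mem_biUnion.2 ⟨b', hb', hΓ⟩, hmem⟩
  choose 𝒞 h𝒞 using hcurves
  refine ⟨F.biUnion 𝒞, ?_, ?_, ?_⟩
  · calc ((F.biUnion 𝒞).card : ℝ) ≤ ∑ b ∈ F, ((𝒞 b).card : ℝ) := by
          exact_mod_cast Finset.card_biUnion_le
      _ ≤ F.card * ((129 ^ 2 + p) * (discConst n (growthConst p) * h ^ 2)) := by
          rw [← nsmul_eq_mul]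
          exact Finset.sum_le_card_nsmul _ _ _ fun b hb => (h𝒞 b hb).1
      _ ≤ (129 ^ 2 + p) * ((129 ^ 2 + p) * (discConst n (growthConst p) * H ^ ε)) := by
          gcongr; exact_mod_cast hFcard
      _ = _ := by push_cast; ring
  · intro Γ hΓ
    obtain ⟨b, hb, hΓ'⟩ := Finset.mem_biUnion.1 hΓ
    exact (h𝒞 b hb).2.1 Γ hΓ'
  · intro z hz hrat
    obtain ⟨b, hb, hzb⟩ := hFcov z hz (norm_le_of_mem_rationalPointsOfHeightLE hrat).1
    obtain ⟨Γ, hΓ, hmem⟩ := (h𝒞 b hb).2.2 z hzb hrat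
    exact ⟨Γ, Finset.mem_biUnion.2 ⟨b, hb, hΓ⟩, hmem⟩
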